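/- For $a,q\in\mathbb C$ and $m\in\mathbb N_0$ write $(a;q)_m=\prod_{i=0}^{m-1}(1-aq^i)$. For $|q|<1$ let $$R^{(3)}_3(q)=\sum_{n_3\ge n_2\ge n_1\ge 0}\frac{(-1)^{n_3}q^{n_3^2+2n_3}(q;q^2)_{n_3}}{(-q^2;q^2)_{n_3}}\,B_3(n_3,n_2,n_1;q^2),$$ $$B_3(n_3,n_2,n_1;q)=\frac{(-1)^{n_1}(-q;q)_{n_2}\,q^{\binom{n_2+1}{2}}\,q^{n_1}\,(-q;q)_{2n_1}}{(q;q)_{n_3-n_2}\,(q^2;q^2)_{n_2-n_1}\,(q^4;q^4)_{n_1}} .$$ **Theorem.** Let $M>0$. There exist $\beta>0$, a real constant $C$ and $N\in\mathbb N$ (depending only on $M$) such that for every integer $n\ge N$ and every real $u$ with $|u-\tfrac12|>Mv$, where $v=\frac{1}{\sqrt{192n}}$ and $q=e^{2\pi i(u+iv)}$, the series defining $R^{(3)}_3(q)$ converges absolutely and $$\bigl|R^{(3)}_3(q)\bigr|\le C\,e^{\pi\sqrt{n/12}\,(1-\beta)} .$$ -/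

import Mathlib

/-- The finite `q`-Pochhammer symbol `(a; q)_m = (1 - a) (1 - a q) ⋯ (1 - a q^(m-1))`. -/
noncomputable def qPochhammer (a q : ℂ) (m : ℕ) : ℂ :=
  ∏ i ∈ Finset.range m, (1 - a * q ^ i)

/-- The entries of a chain `n₁ ≤ ⋯ ≤ n_k`, numbered from `1` to `k` and stored as
`n : Fin k → ℕ`, with the convention `n₀ = 0` (positions beyond `k` are never used). -/
def chainEntry {k : ℕ} (n : Fin k → ℕ) (i : ℕ) : ℕ :=
  if h : 1 ≤ i ∧ i ≤ k then n ⟨i - 1, by omega⟩ else 0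

/-- The summand `B_k(n_k, …, n₁; q)`, where `(-q)_m = (-q; q)_m`. -/
noncomputable def baileyB (k : ℕ) (n : Fin k → ℕ) (q : ℂ) : ℂ :=
  (-1) ^ chainEntry n 1 * qPochhammer (-q) q (chainEntry n (k - 1))
    * q ^ (chainEntry n (k - 1) + 1).choose 2
    * (∏ j ∈ Finset.Icc 2 (k - 1),
        q ^ (2 ^ (j - 2) * chainEntry n (k - j))
          * qPochhammer (-q ^ 2 ^ (j - 2)) (q ^ 2 ^ (j - 2)) (2 * chainEntry n (k - j)))
    / ∏ j ∈ Finset.Icc 1 k,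
        qPochhammer (q ^ 2 ^ (j - 1)) (q ^ 2 ^ (j - 1))
          (chainEntry n (k - j + 1) - chainEntry n (k - j))

/-- The summand of `R^{(k)}_3(q)` at the chain `0 ≤ n₁ ≤ ⋯ ≤ n_k`. -/
noncomputable def baileyR3Term (k : ℕ) (q : ℂ) (n : Fin k → ℕ) : ℂ :=
  (-1) ^ chainEntry n k * q ^ (chainEntry n k ^ 2 + 2 * chainEntry n k)
    * qPochhammer q (q ^ 2) (chainEntry n k) / qPochhammer (-q ^ 2) (q ^ 2) (chainEntry n k)
    * baileyB k n (q ^ 2)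

/-- `R^{(k)}_3(q)`: the sum of the terms above over all chains `n_k ≥ ⋯ ≥ n₁ ≥ 0`. -/
noncomputable def baileyR3 (k : ℕ) (q : ℂ) : ℂ :=
  ∑' n : {n : Fin k → ℕ // Monotone n}, baileyR3Term k q n.1

/-- The nome `q = e^{2πiτ}`. -/
noncomputable def nome (τ : ℂ) : ℂ := Complex.exp (2 * Real.pi * Complex.I * τ)

/-!
Write `|q| = e^{-t}`. A Bailey pair of Hecke type turns the innermost sums into
`(q; q²)_∞ / (q²; q²)_∞` times a double sum which is bounded by a power of `(1 - e^{-t})⁻¹`.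
The quotient of infinite products is of order `e^{π²/24t}` only close to `q = -1`; outside a sector
at that point it is exponentially smaller.

Inside the sector the product cannot be used, and cancellation is exploited at the level of the
finite sums instead: the inner sums are expanded in Gaussian binomials over the denominators
`(-q²; q⁴)_{k+1}`. With `r = |q|`, the numerators are bounded both by `(-r; r²)_∞` and, through
the finite products, by `1 / (r²; r²)_{2k+1}`. At every `k` the better of the two bounds makes the
term exponentially smaller than `e^{π²/24t}`, so the estimate holds on the whole circle.
-/

open Finset Filter Topology

lemma qPochhammer_zero (a q : ℂ) : qPochhammer a q 0 = 1 := by simp [qPochhammer]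

lemma qPochhammer_zero_left (q : ℂ) (m : ℕ) : qPochhammer 0 q m = 1 := by simp [qPochhammer]

lemma qPochhammer_succ (a q : ℂ) (m : ℕ) :
    qPochhammer a q (m + 1) = qPochhammer a q m * (1 - a * q ^ m) := by
  simp [qPochhammer, prod_range_succ]

lemma qPochhammer_add (a q : ℂ) (m n : ℕ) :
    qPochhammer a q (m + n) = qPochhammer a q m * qPochhammer (a * q ^ m) q n := by
  simp only [qPochhammer, prod_range_add, pow_add, mul_assoc]

lemma qPochhammer_succ_left (a q : ℂ) (m : ℕ) :
    qPochhammer a q (m + 1) = (1 - a) * qPochhammer (a * q) q m := by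
  rw [add_comm m 1, qPochhammer_add, qPochhammer_succ, qPochhammer_zero, pow_zero, mul_one, one_mul,
    pow_one]

lemma norm_pow_succ_lt_one {p : ℂ} (hp : ‖p‖ < 1) (n : ℕ) : ‖p ^ (n + 1)‖ < 1 := by
  rw [norm_pow]
  exact pow_lt_one₀ (norm_nonneg p) hp n.succ_ne_zero

lemma norm_mul_pow_lt_one {a p : ℂ} (ha : ‖a‖ < 1) (hp : ‖p‖ < 1) (i : ℕ) : ‖a * p ^ i‖ < 1 := by
  rw [norm_mul, norm_pow]
  exact mul_lt_one_of_nonneg_of_lt_one_left (norm_nonneg a) ha (pow_le_one₀ (norm_nonneg p) hp.le)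

lemma one_sub_pow_succ_ne_zero {p : ℂ} (hp : ‖p‖ < 1) (n : ℕ) : 1 - p ^ (n + 1) ≠ 0 :=
  (isUnit_one_sub_of_norm_lt_one (norm_pow_succ_lt_one hp n)).ne_zero

lemma qPochhammer_ne_zero {a p : ℂ} (ha : ‖a‖ < 1) (hp : ‖p‖ < 1) (m : ℕ) :
    qPochhammer a p m ≠ 0 :=
  prod_ne_zero_iff.mpr fun i _ =>
    (isUnit_one_sub_of_norm_lt_one (norm_mul_pow_lt_one ha hp i)).ne_zero

/-- The reciprocal `q`-factorial `1 / (p; p)_n`. -/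
noncomputable def qFactInv (p : ℂ) (n : ℕ) : ℂ := (qPochhammer p p n)⁻¹

lemma qFactInv_zero (p : ℂ) : qFactInv p 0 = 1 := by simp [qFactInv, qPochhammer_zero]

lemma qFactInv_ne_zero {p : ℂ} (hp : ‖p‖ < 1) (n : ℕ) : qFactInv p n ≠ 0 :=
  inv_ne_zero (qPochhammer_ne_zero hp hp n)

lemma one_sub_mul_qFactInv_succ {p : ℂ} (hp : ‖p‖ < 1) (n : ℕ) :
    (1 - p ^ (n + 1)) * qFactInv p (n + 1) = qFactInv p n := by
  rw [qFactInv, qPochhammer_succ, ← pow_succ', mul_inv, mul_left_comm,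
    mul_inv_cancel₀ (one_sub_pow_succ_ne_zero hp n), mul_one, qFactInv]

/-! ### Finite `q`-series identities -/

/-- The `q`-binomial sum `∑_{i + j = n} c i j / ((p; p)_i (p; p)_j)`. -/
noncomputable def qBinomialSum (p : ℂ) (n : ℕ) (c : ℕ → ℕ → ℂ) : ℂ :=
  ∑ x ∈ antidiagonal n, qFactInv p x.1 * qFactInv p x.2 * c x.1 x.2

lemma qBinomialSum_zero (p : ℂ) (c : ℕ → ℕ → ℂ) : qBinomialSum p 0 c = c 0 0 := by
  simp [qBinomialSum, qFactInv_zero]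

lemma qBinomialSum_congr (p : ℂ) {n : ℕ} {c d : ℕ → ℕ → ℂ} (h : ∀ i j, i + j = n → c i j = d i j) :
    qBinomialSum p n c = qBinomialSum p n d :=
  sum_congr rfl fun x hx => by rw [h x.1 x.2 (mem_antidiagonal.mp hx)]

lemma qBinomialSum_add (p : ℂ) (n : ℕ) (c d : ℕ → ℕ → ℂ) :
    qBinomialSum p n (fun i j => c i j + d i j) = qBinomialSum p n c + qBinomialSum p n d := by
  simp only [qBinomialSum, mul_add, sum_add_distrib]

lemma qBinomialSum_const_mul (p : ℂ) (n : ℕ) (b : ℂ) (c : ℕ → ℕ → ℂ) :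
    qBinomialSum p n (fun i j => b * c i j) = b * qBinomialSum p n c := by
  simp only [qBinomialSum, mul_left_comm _ b, mul_sum]

section

variable {p : ℂ}

lemma qBinomialSum_one_sub_fst (hp : ‖p‖ < 1) (n : ℕ) (c : ℕ → ℕ → ℂ) :
    qBinomialSum p (n + 1) (fun i j => (1 - p ^ i) * c i j)
      = qBinomialSum p n fun i j => c (i + 1) j := by
  rw [qBinomialSum, Nat.sum_antidiagonal_succ, pow_zero, sub_self, zero_mul, mul_zero, zero_add]
  refine sum_congr rfl fun x _ => ?_
  rw [← one_sub_mul_qFactInv_succ hp x.1]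
  ring

lemma qBinomialSum_one_sub_snd (hp : ‖p‖ < 1) (n : ℕ) (c : ℕ → ℕ → ℂ) :
    qBinomialSum p (n + 1) (fun i j => (1 - p ^ j) * c i j)
      = qBinomialSum p n fun i j => c i (j + 1) := by
  rw [qBinomialSum, Nat.sum_antidiagonal_succ', pow_zero, sub_self, zero_mul, mul_zero, zero_add]
  refine sum_congr rfl fun x _ => ?_
  rw [← one_sub_mul_qFactInv_succ hp x.2]
  ring

/- The two `q`-Pascal rules, from `1 - p ^ (i + j) = (1 - p ^ j) + p ^ j * (1 - p ^ i)` and its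
mirror image. -/

lemma one_sub_mul_qBinomialSum_succ (hp : ‖p‖ < 1) (n : ℕ) (c : ℕ → ℕ → ℂ) :
    (1 - p ^ (n + 1)) * qBinomialSum p (n + 1) c
      = qBinomialSum p n fun i j => c i (j + 1) + p ^ j * c (i + 1) j := by
  rw [qBinomialSum_add, ← qBinomialSum_one_sub_snd hp,
    ← qBinomialSum_one_sub_fst hp n fun i j => p ^ j * c i j, ← qBinomialSum_const_mul,
    ← qBinomialSum_add]
  refine qBinomialSum_congr p fun i j h => ?_
  rw [← h]
  ring

lemma one_sub_mul_qBinomialSum_succ' (hp : ‖p‖ < 1) (n : ℕ) (c : ℕ → ℕ → ℂ) :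
    (1 - p ^ (n + 1)) * qBinomialSum p (n + 1) c
      = qBinomialSum p n fun i j => c (i + 1) j + p ^ i * c i (j + 1) := by
  rw [qBinomialSum_add, ← qBinomialSum_one_sub_fst hp,
    ← qBinomialSum_one_sub_snd hp n fun i j => p ^ i * c i j, ← qBinomialSum_const_mul,
    ← qBinomialSum_add]
  refine qBinomialSum_congr p fun i j h => ?_
  rw [← h]
  ring

/-- The numerator of the `₁φ₁` series with parameters `a` and `a * y`. -/
noncomputable def onePhiOneCoeff (p a y : ℂ) (i : ℕ) : ℂ :=
  (-1) ^ i * p ^ i.choose 2 * qPochhammer a p i * (qPochhammer (a * y) p i)⁻¹ * y ^ i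

lemma onePhiOneCoeff_succ (p a y : ℂ) (i : ℕ) :
    onePhiOneCoeff p a y (i + 1)
      = -(y * (1 - a) * (1 - a * y)⁻¹) * p ^ i * onePhiOneCoeff p (a * p) y i := by
  simp only [onePhiOneCoeff, qPochhammer_succ_left, Nat.choose_succ_succ' i 1, Nat.choose_one_right,
    pow_add, mul_inv, mul_right_comm a y p]
  ring

/-- The finite `q`-Chu–Vandermonde sum. -/
lemma qBinomialSum_onePhiOneCoeff (hp : ‖p‖ < 1) (y : ℂ) (n : ℕ) {a : ℂ} (ha : ‖a * y‖ < 1) :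
    qBinomialSum p n (fun i _ => onePhiOneCoeff p a y i)
      = qFactInv p n * qPochhammer y p n * (qPochhammer (a * y) p n)⁻¹ := by
  induction n generalizing a with
  | zero => simp [qBinomialSum_zero, onePhiOneCoeff, qFactInv_zero, qPochhammer_zero]
  | succ n ih =>
    have ha' : ‖a * p * y‖ < 1 := by
      simpa [mul_right_comm] using norm_mul_pow_lt_one ha hp 1
    have hshift : qBinomialSum p n (fun i j => p ^ j * onePhiOneCoeff p a y (i + 1))
        = -(y * (1 - a) * (1 - a * y)⁻¹ * p ^ n) *
          (qFactInv p n * qPochhammer y p n * (qPochhammer (a * p * y) p n)⁻¹) := by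
      rw [← ih ha', ← qBinomialSum_const_mul]
      refine qBinomialSum_congr p fun i j h => ?_
      rw [onePhiOneCoeff_succ, ← h, pow_add]
      ring
    have hratio : (1 - a * y)⁻¹ * (qPochhammer (a * p * y) p n)⁻¹
        = (qPochhammer (a * y) p n)⁻¹ * (1 - a * y * p ^ n)⁻¹ := by
      rw [← mul_inv, ← mul_inv, ← qPochhammer_succ, qPochhammer_succ_left, mul_right_comm a y p]
    have hne : 1 - a * y * p ^ n ≠ 0 :=
      (isUnit_one_sub_of_norm_lt_one (norm_mul_pow_lt_one ha hp n)).ne_zero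
    apply mul_left_cancel₀ (one_sub_pow_succ_ne_zero hp n)
    rw [one_sub_mul_qBinomialSum_succ hp, qBinomialSum_add, ih ha, hshift]
    calc _ = qFactInv p n * qPochhammer y p n * ((qPochhammer (a * y) p n)⁻¹ -
          y * (1 - a) * p ^ n * ((1 - a * y)⁻¹ * (qPochhammer (a * p * y) p n)⁻¹)) := by ring
      _ = qFactInv p n * (qPochhammer y p n * (1 - y * p ^ n)) *
          ((qPochhammer (a * y) p n)⁻¹ * (1 - a * y * p ^ n)⁻¹) := by
        rw [hratio]
        field_simp
        ring
      _ = _ := by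
        rw [← one_sub_mul_qFactInv_succ hp n, qPochhammer_succ, qPochhammer_succ, mul_inv]
        ring

lemma qBinomialSum_pow_choose_two (hp : ‖p‖ < 1) (y : ℂ) (n : ℕ) :
    qBinomialSum p n (fun i _ => (-1) ^ i * p ^ i.choose 2 * y ^ i)
      = qFactInv p n * qPochhammer y p n := by
  simpa [onePhiOneCoeff, qPochhammer_zero_left]
    using qBinomialSum_onePhiOneCoeff hp y n (a := 0) (by simp)

/-- Gauss's alternating sum of `q`-binomial coefficients. -/
lemma qBinomialSum_neg_one_pow (hp : ‖p‖ < 1) (n : ℕ) :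
    qBinomialSum p (2 * n) (fun i _ => (-1) ^ i) = qFactInv (p ^ 2) n := by
  have two_step (N : ℕ) : (1 - p ^ (N + 2)) * qBinomialSum p (N + 2) (fun i _ => (-1) ^ i)
      = qBinomialSum p N (fun i _ => (-1) ^ i) := by
    rw [one_sub_mul_qBinomialSum_succ' hp, qBinomialSum_congr p fun i j _ =>
        show (-1 : ℂ) ^ (i + 1) + p ^ i * (-1) ^ i = (1 - p ^ i) * (-1) ^ (i + 1) by ring,
      qBinomialSum_one_sub_fst hp]
    simp only [pow_succ, mul_neg_one, neg_neg]
  have hp2 : ‖p ^ 2‖ < 1 := norm_pow_succ_lt_one hp 1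
  induction n with
  | zero => simp [qBinomialSum_zero, qFactInv_zero]
  | succ n ih =>
    apply mul_left_cancel₀ (one_sub_pow_succ_ne_zero hp2 n)
    rw [one_sub_mul_qFactInv_succ hp2, ← ih, ← two_step (2 * n), ← pow_mul]
    rfl

lemma qBinomialSum_qPochhammer (hp : ‖p‖ < 1) (x : ℂ) (n : ℕ) :
    qBinomialSum p n (fun i j => x ^ j * qPochhammer x p i) = qFactInv p n := by
  induction n with
  | zero => simp [qBinomialSum_zero, qFactInv_zero, qPochhammer_zero]
  | succ n ih =>
    apply mul_left_cancel₀ (one_sub_pow_succ_ne_zero hp n)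
    rw [one_sub_mul_qBinomialSum_succ' hp, one_sub_mul_qFactInv_succ hp, ← ih]
    refine qBinomialSum_congr p fun i j _ => ?_
    rw [qPochhammer_succ]
    ring

end

/-- The partial sums `∑_{a ≤ b} x^a / (p; p)_a` of the `q`-exponential series. -/
noncomputable def qExpPartial (p x : ℂ) (b : ℕ) : ℂ :=
  ∑ a ∈ range (b + 1), x ^ a * qFactInv p a

lemma qExpPartial_zero (p x : ℂ) : qExpPartial p x 0 = 1 := by simp [qExpPartial, qFactInv_zero]

lemma qExpPartial_succ (p x : ℂ) (b : ℕ) :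
    qExpPartial p x (b + 1) = qExpPartial p x b + x ^ (b + 1) * qFactInv p (b + 1) :=
  sum_range_succ _ _

lemma qBinomialSum_eq_qExpPartial {x : ℂ} (hx : ‖x ^ 2‖ < 1) (b : ℕ) :
    qBinomialSum (x ^ 2) b (fun i _ => x ^ i * qPochhammer x (x ^ 2) i)
      = qExpPartial (x ^ 2) x b := by
  induction b with
  | zero => simp [qBinomialSum_zero, qExpPartial_zero, qPochhammer_zero]
  | succ b ih =>
    have hsplit (i j : ℕ) (h : i + j = b + 1) : x ^ i * qPochhammer x (x ^ 2) i
        = (1 - (x ^ 2) ^ j) * (x ^ i * qPochhammer x (x ^ 2) i)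
          + x ^ (b + 1) * (x ^ j * qPochhammer x (x ^ 2) i) := by
      rw [← h]
      ring
    rw [qBinomialSum_congr _ hsplit, qBinomialSum_add, qBinomialSum_one_sub_snd hx, ih,
      qBinomialSum_const_mul, qBinomialSum_qPochhammer hx, qExpPartial_succ]

section

variable {p x : ℂ}

lemma one_sub_mul_qExpPartial (hp : ‖p‖ < 1) (x : ℂ) (b : ℕ) :
    (1 - x) * qExpPartial p x b = qExpPartial p (x * p) b - x ^ (b + 1) * qFactInv p b := by
  induction b with
  | zero => simp [qExpPartial_zero, qFactInv_zero]
  | succ b ih =>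
    rw [qExpPartial_succ, mul_add, ih, qExpPartial_succ, ← one_sub_mul_qFactInv_succ hp b]
    ring

lemma qExpPartial_expansion (hp : ‖p‖ < 1) (hx : ‖x‖ < 1) (b N : ℕ) :
    qExpPartial p x b = (qPochhammer x p N)⁻¹ * qExpPartial p (x * p ^ N) b
      - qFactInv p b * ∑ k ∈ range N, (x * p ^ k) ^ (b + 1) * (qPochhammer x p (k + 1))⁻¹ := by
  induction N with
  | zero => simp [qPochhammer_zero]
  | succ N ih =>
    have hne : 1 - x * p ^ N ≠ 0 :=
      (isUnit_one_sub_of_norm_lt_one (norm_mul_pow_lt_one hx hp N)).ne_zero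
    have hstep : qExpPartial p (x * p ^ N) b = (1 - x * p ^ N)⁻¹ *
        (qExpPartial p (x * p ^ (N + 1)) b - (x * p ^ N) ^ (b + 1) * qFactInv p b) := by
      rw [pow_succ, ← mul_assoc, ← one_sub_mul_qExpPartial hp, inv_mul_cancel_left₀ hne]
    rw [ih, hstep, sum_range_succ, qPochhammer_succ, mul_inv]
    ring

end

/-! ### A Bailey pair of Hecke type -/

lemma sum_range_two_mul_add_one (f : ℕ → ℂ) (N : ℕ) :
    ∑ k ∈ range (2 * N + 1), f k = ∑ i ∈ range N, (f (N - 1 - i) + f (N + (i + 1))) + f N := by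
  rw [show 2 * N + 1 = N + (N + 1) by omega, sum_range_add, sum_range_succ' _ N,
    ← sum_range_reflect _ N, sum_add_distrib, add_assoc, add_zero]

lemma neg_one_pow_mul_self (m : ℕ) : (-1 : ℂ) ^ m * (-1) ^ m = 1 :=
  pow_mul_pow_eq_one m (by norm_num)

lemma qFactInv_add (p : ℂ) (m n : ℕ) :
    qFactInv p (m + n) = qFactInv p m * (qPochhammer (p ^ (m + 1)) p n)⁻¹ := by
  rw [qFactInv, qPochhammer_add, mul_inv, ← pow_succ', qFactInv]

lemma choose_two_add (r i : ℕ) :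
    (r + i + 1).choose 2 = (r + 1).choose 2 + i.choose 2 + (r + 1) * i := by
  induction i with
  | zero => simp
  | succ i ih =>
    rw [← add_assoc, Nat.choose_succ_succ' (r + i + 1) 1, ih, Nat.choose_succ_succ' i 1,
      Nat.choose_one_right, Nat.choose_one_right]
    ring

/-- The weights `1, -2, 2, -2, …` of a symmetric alternating sum, folded onto `ℕ`. -/
noncomputable def alternatingWeight (j : ℕ) : ℂ := if j = 0 then 1 else 2 * (-1) ^ j

/-- The Hecke-type polynomial `∑_{|j| ≤ r} (-1)^j p^(2r² - 2j² + r)`. -/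
noncomputable def heckeCoeff (p : ℂ) (r : ℕ) : ℂ :=
  ∑ j ∈ range (r + 1), alternatingWeight j * p ^ (2 * ((r - j) * (r + j)) + r)

/-- The Bailey transform relative to `a = p`: `(α, β)` is a Bailey pair when
`β n = baileyTransform p α n`. The customary denominator `(p²; p)_{n+r}` is replaced by
`(p; p)_{n+r+1}`, a constant factor `1 - p`. -/
noncomputable def baileyTransform (p : ℂ) (α : ℕ → ℂ) (n : ℕ) : ℂ :=
  ∑ r ∈ range (n + 1), α r * (qFactInv p (n - r) * qFactInv p (n + r + 1))

section

variable {p : ℂ}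

lemma sum_alternatingWeight (hp : ‖p‖ < 1) (N : ℕ) :
    ∑ j ∈ range (N + 1), alternatingWeight j * (qFactInv p (N - j) * qFactInv p (N + j))
      = (-1) ^ N * qFactInv (p ^ 2) N := by
  rw [← qBinomialSum_neg_one_pow hp N, qBinomialSum, Nat.sum_antidiagonal_eq_sum_range_succ
    (f := fun i j => qFactInv p i * qFactInv p j * (-1) ^ i), Nat.succ_eq_add_one,
    sum_range_two_mul_add_one, sum_range_succ' _ N, mul_add, mul_sum]
  congr 1
  · refine sum_congr rfl fun i hi => ?_
    obtain ⟨d, rfl⟩ := Nat.exists_eq_add_of_lt (mem_range.mp hi)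
    rw [show i + d + 1 - 1 - i = d by omega,
      show 2 * (i + d + 1) - d = i + d + 1 + (i + 1) by omega,
      show i + d + 1 - (i + 1) = d by omega,
      show 2 * (i + d + 1) - (i + d + 1 + (i + 1)) = d by omega, alternatingWeight,
      if_neg i.succ_ne_zero, pow_add (-1 : ℂ) (i + d + 1) (i + 1), add_right_comm i d 1,
      pow_add (-1 : ℂ) (i + 1) d]
    linear_combination (-(-1) ^ (i + 1) * (qFactInv p d * qFactInv p (i + 1 + d + (i + 1)))) *
      (2 * neg_one_pow_mul_self d + neg_one_pow_mul_self (i + 1) * ((-1) ^ d * (-1) ^ d))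
  · simp only [alternatingWeight, if_pos, Nat.sub_zero, add_zero, show 2 * N - N = N by omega]
    linear_combination (-(qFactInv p N * qFactInv p N)) * neg_one_pow_mul_self N

lemma baileyTransform_succ_sub (hp : ‖p‖ < 1) (α : ℕ → ℂ) (n : ℕ) :
    baileyTransform p α (n + 1) - baileyTransform p α n
      = ∑ r ∈ range (n + 1 + 1), α r * (qFactInv p (n + 1 - r) * qFactInv p (n + 1 + r + 1) *
          (1 - (1 - p ^ (n + 1 - r)) * (1 - p ^ (n + 1 + r + 1)))) := by
  have hlower : baileyTransform p α n
      = ∑ r ∈ range (n + 1 + 1), α r * (qFactInv p (n + 1 - r) * qFactInv p (n + 1 + r + 1) *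
          ((1 - p ^ (n + 1 - r)) * (1 - p ^ (n + 1 + r + 1)))) := by
    rw [baileyTransform, sum_range_succ _ (n + 1), Nat.sub_self, pow_zero, sub_self, zero_mul,
      mul_zero, mul_zero, add_zero]
    refine sum_congr rfl fun r hr => ?_
    obtain ⟨d, rfl⟩ := Nat.exists_eq_add_of_le (mem_range_succ_iff.mp hr)
    rw [Nat.add_sub_cancel_left, add_assoc r d 1, Nat.add_sub_cancel_left,
      ← one_sub_mul_qFactInv_succ hp d, ← one_sub_mul_qFactInv_succ hp (r + d + r + 1),
      show r + (d + 1) + r + 1 = r + d + r + 1 + 1 by ring]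
    ring
  rw [hlower, baileyTransform, ← sum_sub_distrib]
  exact sum_congr rfl fun r _ => by ring

lemma sum_Ico_hecke_telescope (hp : ‖p‖ < 1) {j N : ℕ} (hj : j ≤ N) :
    ∑ r ∈ Ico j (N + 1), (1 - p ^ (2 * r + 1)) * p ^ (2 * ((r - j) * (r + j)) + r) *
        (qFactInv p (N - r) * qFactInv p (N + r + 1) *
          (1 - (1 - p ^ (N - r)) * (1 - p ^ (N + r + 1))))
      = p ^ N * (qFactInv p (N - j) * qFactInv p (N + j)) := by
  let U (r : ℕ) : ℂ :=
    p ^ (2 * ((r - j) * (r + j)) + N) * (qFactInv p (N - r) * qFactInv p (N + r))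
  have hstep (r : ℕ) (hr : r ∈ Ico j N) :
      (1 - p ^ (2 * r + 1)) * p ^ (2 * ((r - j) * (r + j)) + r) *
        (qFactInv p (N - r) * qFactInv p (N + r + 1) *
          (1 - (1 - p ^ (N - r)) * (1 - p ^ (N + r + 1)))) = -(U (r + 1) - U r) := by
    obtain ⟨hjr, hrN⟩ := mem_Ico.mp hr
    obtain ⟨i, rfl⟩ := Nat.exists_eq_add_of_le hjr
    obtain ⟨d, rfl⟩ := Nat.exists_eq_add_of_lt hrN
    simp only [U]
    rw [show j + i + d + 1 - (j + i) = d + 1 by omega, Nat.add_sub_cancel_left,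
      show j + i + 1 - j = i + 1 by omega, show j + i + d + 1 - (j + i + 1) = d by omega,
      ← one_sub_mul_qFactInv_succ hp d, ← one_sub_mul_qFactInv_succ hp (j + i + d + 1 + (j + i)),
      ← add_assoc (j + i + d + 1) (j + i) 1]
    ring
  have hlast : (1 - p ^ (2 * N + 1)) * p ^ (2 * ((N - j) * (N + j)) + N) *
        (qFactInv p (N - N) * qFactInv p (N + N + 1) *
          (1 - (1 - p ^ (N - N)) * (1 - p ^ (N + N + 1)))) = U N := by
    simp only [U]
    rw [← one_sub_mul_qFactInv_succ hp (N + N), Nat.sub_self]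
    ring
  rw [sum_Ico_succ_top hj, sum_congr rfl hstep, sum_neg_distrib, sum_Ico_sub U hj, hlast,
    neg_sub, sub_add_cancel]
  simp [U]

/-- The Bailey pair of Hecke type with `β_n = ∑_{a ≤ n} (-p)^a / (p²; p²)_a`. -/
lemma baileyTransform_heckeCoeff (hp : ‖p‖ < 1) (n : ℕ) :
    baileyTransform p (fun r => (1 - p ^ (2 * r + 1)) * heckeCoeff p r) n
      = qExpPartial (p ^ 2) (-p) n := by
  induction n with
  | zero =>
    have hone : (1 - p) * qFactInv p 1 = 1 := by
      simpa [qFactInv_zero] using one_sub_mul_qFactInv_succ hp 0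
    simp [baileyTransform, qExpPartial_zero, qFactInv_zero, heckeCoeff, alternatingWeight, hone]
  | succ n ih =>
    have hdiff : baileyTransform p (fun r => (1 - p ^ (2 * r + 1)) * heckeCoeff p r) (n + 1)
        - baileyTransform p (fun r => (1 - p ^ (2 * r + 1)) * heckeCoeff p r) n
          = (-p) ^ (n + 1) * qFactInv (p ^ 2) (n + 1) := by
      rw [baileyTransform_succ_sub hp, neg_pow, mul_right_comm, ← sum_alternatingWeight hp, sum_mul]
      simp only [heckeCoeff, mul_sum, sum_mul, range_eq_Ico]
      rw [← sum_Ico_Ico_comm 0 (n + 1 + 1)]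
      refine sum_congr rfl fun j hj => ?_
      rw [mul_assoc, mul_comm _ (p ^ (n + 1)),
        ← sum_Ico_hecke_telescope hp (Nat.lt_succ_iff.mp (mem_Ico.mp hj).2), mul_sum]
      exact sum_congr rfl fun r _ => by ring
    rw [qExpPartial_succ, ← ih, ← hdiff, add_sub_cancel]

lemma qBinomialSum_neg_qPochhammer (hp : ‖p‖ < 1) (r M : ℕ) :
    qBinomialSum p M (fun i _ =>
        qPochhammer (-p) p (r + i) * p ^ (r + i + 1).choose 2 * qFactInv p (2 * r + 1 + i))
      = qFactInv p M *
        (qPochhammer (-p) p (r + M) * p ^ (r + 1).choose 2 * qFactInv p (2 * r + 1 + M)) := by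
  have hsq : -p ^ (r + 1) * -p ^ (r + 1) = p ^ (2 * r + 1 + 1) := by ring
  have hnorm : ‖-p ^ (r + 1) * -p ^ (r + 1)‖ < 1 := hsq ▸ norm_pow_succ_lt_one hp _
  have hneg (m : ℕ) : qPochhammer (-p) p (r + m)
      = qPochhammer (-p) p r * qPochhammer (-p ^ (r + 1)) p m := by
    rw [qPochhammer_add, neg_mul, ← pow_succ']
  have hcoeff (i : ℕ) :
      qPochhammer (-p) p (r + i) * p ^ (r + i + 1).choose 2 * qFactInv p (2 * r + 1 + i)
        = qPochhammer (-p) p r * p ^ (r + 1).choose 2 * qFactInv p (2 * r + 1) *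
          onePhiOneCoeff p (-p ^ (r + 1)) (-p ^ (r + 1)) i := by
    rw [hneg, qFactInv_add, choose_two_add, pow_add p (_ + _), pow_add p (Nat.choose _ 2), pow_mul,
      onePhiOneCoeff, hsq, neg_pow (p ^ (r + 1)) i]
    linear_combination (-(qPochhammer (-p) p r * p ^ (r + 1).choose 2 * qFactInv p (2 * r + 1) *
      (p ^ i.choose 2 * qPochhammer (-p ^ (r + 1)) p i *
        (qPochhammer (p ^ (2 * r + 1 + 1)) p i)⁻¹ * (p ^ (r + 1)) ^ i))) * neg_one_pow_mul_self i
  rw [qBinomialSum_congr p fun i _ _ => hcoeff i, qBinomialSum_const_mul,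
    qBinomialSum_onePhiOneCoeff hp _ _ hnorm, hsq, hneg, qFactInv_add p _ M]
  ring

/-- The Bailey lemma relative to `a = p`, with one parameter equal to `-p` and the other one
sent to infinity. -/
lemma sum_range_mul_baileyTransform (hp : ‖p‖ < 1) (α : ℕ → ℂ) (n : ℕ) :
    ∑ b ∈ range (n + 1), qPochhammer (-p) p b * p ^ (b + 1).choose 2 * qFactInv p (n - b) *
        baileyTransform p α b
      = qPochhammer (-p) p n * baileyTransform p (fun r => p ^ (r + 1).choose 2 * α r) n := by
  simp only [baileyTransform, mul_sum, range_eq_Ico]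
  rw [← sum_Ico_Ico_comm 0 (n + 1)]
  refine sum_congr rfl fun r hr => ?_
  obtain ⟨M, rfl⟩ := Nat.exists_eq_add_of_le (Nat.lt_succ_iff.mp (mem_Ico.mp hr).2)
  have hinner := qBinomialSum_neg_qPochhammer hp r M
  rw [qBinomialSum, Nat.sum_antidiagonal_eq_sum_range_succ (f := fun i j => qFactInv p i *
    qFactInv p j * (qPochhammer (-p) p (r + i) * p ^ (r + i + 1).choose 2 *
      qFactInv p (2 * r + 1 + i)))] at hinner
  rw [sum_Ico_eq_sum_range, show r + M + 1 - r = M + 1 by omega, Nat.add_sub_cancel_left,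
    show r + M + r + 1 = 2 * r + 1 + M by ring]
  calc _ = α r * ∑ i ∈ range (M + 1), qFactInv p i * qFactInv p (M - i) *
        (qPochhammer (-p) p (r + i) * p ^ (r + i + 1).choose 2 * qFactInv p (2 * r + 1 + i)) := by
        rw [mul_sum]
        refine sum_congr rfl fun i _ => ?_
        rw [Nat.add_sub_add_left, Nat.add_sub_cancel_left,
          show r + i + r + 1 = 2 * r + 1 + i by ring]
        ring
    _ = _ := by
        rw [hinner]
        ring

end

/-! ### Infinite `q`-products -/

/-- The infinite `q`-Pochhammer symbol `(z; p)_∞` for `‖z‖ < 1`, defined through the expansion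
of its logarithm so that it visibly never vanishes. -/
noncomputable def qPochhammerInf (z p : ℂ) : ℂ :=
  Complex.exp (-∑' m : ℕ, z ^ (m + 1) / ((m + 1) * (1 - p ^ (m + 1))))

lemma qPochhammerInf_ne_zero (z p : ℂ) : qPochhammerInf z p ≠ 0 := Complex.exp_ne_zero _

lemma one_sub_norm_le_norm_one_sub_pow {p : ℂ} (hp : ‖p‖ ≤ 1) (m : ℕ) :
    1 - ‖p‖ ≤ ‖1 - p ^ (m + 1)‖ := by
  have htri : ‖(1 : ℂ)‖ - ‖p ^ (m + 1)‖ ≤ ‖1 - p ^ (m + 1)‖ := norm_sub_norm_le _ _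
  rw [norm_one, norm_pow] at htri
  linarith [pow_le_of_le_one (norm_nonneg p) hp m.add_one_ne_zero]

lemma norm_natCast_add_one (m : ℕ) : ‖((m : ℂ) + 1)‖ = m + 1 := by
  exact_mod_cast Complex.norm_natCast (m + 1)

lemma exists_norm_le_of_tendsto {u : ℕ → ℂ} {l : ℂ} (h : Tendsto u atTop (𝓝 l)) :
    ∃ C : ℝ, 0 < C ∧ ∀ n, ‖u n‖ ≤ C := by
  obtain ⟨C, hC, hle⟩ := (Metric.isBounded_range_of_tendsto u h).exists_pos_norm_le
  exact ⟨C, hC, fun n => hle _ ⟨n, rfl⟩⟩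

lemma tendsto_sum_range_mul {f : ℕ → ℂ} (hf : Summable fun i => ‖f i‖) {g : ℕ → ℕ → ℂ} {C : ℝ}
    (hbound : ∀ n i, ‖g n i‖ ≤ C) (hlim : ∀ i, Tendsto (fun n => g n i) atTop (𝓝 1)) :
    Tendsto (fun n => ∑ i ∈ range (n + 1), g n i * f i) atTop (𝓝 (∑' i, f i)) := by
  have hC : 0 ≤ C := (norm_nonneg _).trans (hbound 0 0)
  have htrunc (n : ℕ) : ∑ i ∈ range (n + 1), g n i * f i
      = ∑' i, if i ∈ range (n + 1) then g n i * f i else 0 := by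
    rw [tsum_eq_sum (s := range (n + 1)) fun i hi => if_neg hi]
    exact sum_congr rfl fun i hi => (if_pos hi).symm
  simp only [htrunc]
  refine tendsto_tsum_of_dominated_convergence (hf.mul_left C) (fun i => ?_)
    (Eventually.of_forall fun n i => ?_)
  · have hi : Tendsto (fun n => g n i * f i) atTop (𝓝 (f i)) := by
      simpa using (hlim i).mul_const (f i)
    refine hi.congr' ?_
    filter_upwards [eventually_ge_atTop i] with n hn
    rw [if_pos (mem_range_succ_iff.mpr hn)]
  · split_ifs
    · rw [norm_mul]
      exact mul_le_mul_of_nonneg_right (hbound n i) (norm_nonneg _)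
    · rw [norm_zero]
      positivity

section

variable {p : ℂ}

lemma norm_logTerm_le (hp : ‖p‖ < 1) (z : ℂ) (m : ℕ) :
    ‖z ^ (m + 1) / ((m + 1) * (1 - p ^ (m + 1)))‖ ≤ ‖z‖ ^ (m + 1) * (1 - ‖p‖)⁻¹ := by
  have hden : 1 - ‖p‖ ≤ ((m : ℝ) + 1) * ‖1 - p ^ (m + 1)‖ :=
    (one_sub_norm_le_norm_one_sub_pow hp.le m).trans
      (le_mul_of_one_le_left (norm_nonneg _) (by simp))
  rw [norm_div, norm_mul, norm_pow, norm_natCast_add_one, div_eq_mul_inv]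
  gcongr

lemma summable_pow_succ {r : ℝ} (h0 : 0 ≤ r) (h1 : r < 1) : Summable fun m : ℕ => r ^ (m + 1) :=
  (summable_nat_add_iff 1).mpr (summable_geometric_of_lt_one h0 h1)

lemma summable_logTerm {z : ℂ} (hz : ‖z‖ < 1) (hp : ‖p‖ < 1) :
    Summable fun m : ℕ => z ^ (m + 1) / ((m + 1) * (1 - p ^ (m + 1))) :=
  .of_norm_bounded ((summable_pow_succ (norm_nonneg z) hz).mul_right _) (norm_logTerm_le hp z)

lemma norm_tsum_logTerm_le {z : ℂ} (hz : ‖z‖ < 1) (hp : ‖p‖ < 1) :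
    ‖∑' m : ℕ, z ^ (m + 1) / ((m + 1) * (1 - p ^ (m + 1)))‖
      ≤ ‖z‖ * ((1 - ‖z‖)⁻¹ * (1 - ‖p‖)⁻¹) := by
  refine tsum_of_norm_bounded ?_ (norm_logTerm_le hp z)
  simpa only [pow_succ', mul_assoc] using
    ((hasSum_geometric_of_lt_one (norm_nonneg z) hz).mul_left ‖z‖).mul_right (1 - ‖p‖)⁻¹

lemma hasSum_pow_succ_div {z : ℂ} (hz : ‖z‖ < 1) :
    HasSum (fun m : ℕ => z ^ (m + 1) / (m + 1)) (-Complex.log (1 - z)) := by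
  simpa using (hasSum_nat_add_iff' 1).mpr (Complex.hasSum_taylorSeries_neg_log hz)

lemma qPochhammerInf_eq_mul {z : ℂ} (hz : ‖z‖ < 1) (hp : ‖p‖ < 1) :
    qPochhammerInf z p = (1 - z) * qPochhammerInf (z * p) p := by
  have hlog := hasSum_pow_succ_div hz
  have hzp : ‖z * p‖ < 1 := by simpa using norm_mul_pow_lt_one hz hp 1
  have hsplit : ∑' m : ℕ, z ^ (m + 1) / ((m + 1) * (1 - p ^ (m + 1)))
      = -Complex.log (1 - z) + ∑' m : ℕ, (z * p) ^ (m + 1) / ((m + 1) * (1 - p ^ (m + 1))) := by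
    rw [← hlog.tsum_eq, ← hlog.summable.tsum_add (summable_logTerm hzp hp)]
    refine tsum_congr fun m => ?_
    have := one_sub_pow_succ_ne_zero hp m
    have : (m : ℂ) + 1 ≠ 0 := Nat.cast_add_one_ne_zero m
    field_simp
    ring
  rw [qPochhammerInf, hsplit, neg_add, neg_neg, Complex.exp_add,
    Complex.exp_log (isUnit_one_sub_of_norm_lt_one hz).ne_zero, qPochhammerInf]

lemma qPochhammer_mul_inf {z : ℂ} (hz : ‖z‖ < 1) (hp : ‖p‖ < 1) (n : ℕ) :
    qPochhammer z p n * qPochhammerInf (z * p ^ n) p = qPochhammerInf z p := by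
  induction n with
  | zero => simp [qPochhammer_zero]
  | succ n ih =>
    rw [← ih, qPochhammer_succ, qPochhammerInf_eq_mul (norm_mul_pow_lt_one hz hp n) hp, mul_assoc,
      mul_assoc z, ← pow_succ]

lemma tendsto_norm_mul_pow (hp : ‖p‖ < 1) (a : ℂ) :
    Tendsto (fun n : ℕ => ‖a * p ^ n‖) atTop (𝓝 0) := by
  simpa using (tendsto_pow_atTop_nhds_zero_of_lt_one (norm_nonneg p) hp).const_mul ‖a‖

lemma tendsto_qPochhammerInf_one {z : ℂ} (hz : ‖z‖ < 1) (hp : ‖p‖ < 1) :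
    Tendsto (fun n : ℕ => qPochhammerInf (z * p ^ n) p) atTop (𝓝 1) := by
  have hzero := tendsto_norm_mul_pow hp z
  have hlog : Tendsto
      (fun n : ℕ => ∑' m : ℕ, (z * p ^ n) ^ (m + 1) / ((m + 1) * (1 - p ^ (m + 1))))
      atTop (𝓝 0) := by
    refine squeeze_zero_norm (fun n => norm_tsum_logTerm_le (norm_mul_pow_lt_one hz hp n) hp) ?_
    have hinv : Tendsto (fun n : ℕ => (1 - ‖z * p ^ n‖)⁻¹) atTop (𝓝 (1 - 0)⁻¹) :=
      (tendsto_const_nhds.sub hzero).inv₀ (by norm_num)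
    simpa using hzero.mul (hinv.mul_const (1 - ‖p‖)⁻¹)
  simpa [qPochhammerInf] using hlog.neg.cexp

lemma tendsto_qPochhammer {z : ℂ} (hz : ‖z‖ < 1) (hp : ‖p‖ < 1) :
    Tendsto (fun n => qPochhammer z p n) atTop (𝓝 (qPochhammerInf z p)) := by
  have hlim := ((tendsto_qPochhammerInf_one hz hp).inv₀ one_ne_zero).const_mul (qPochhammerInf z p)
  simp only [inv_one, mul_one] at hlim
  refine hlim.congr fun n => ?_
  rw [← qPochhammer_mul_inf hz hp n, mul_inv_cancel_right₀ (qPochhammerInf_ne_zero _ _)]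

lemma tendsto_qFactInv (hp : ‖p‖ < 1) :
    Tendsto (qFactInv p) atTop (𝓝 (qPochhammerInf p p)⁻¹) :=
  (tendsto_qPochhammer hp hp).inv₀ (qPochhammerInf_ne_zero p p)

lemma exists_norm_inv_qPochhammer_le {z : ℂ} (hz : ‖z‖ < 1) (hp : ‖p‖ < 1) :
    ∃ C : ℝ, 0 < C ∧ ∀ n, ‖(qPochhammer z p n)⁻¹‖ ≤ C :=
  exists_norm_le_of_tendsto ((tendsto_qPochhammer hz hp).inv₀ (qPochhammerInf_ne_zero z p))

lemma exists_norm_qPochhammer_le (hp : ‖p‖ < 1) (a : ℂ) :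
    ∃ C : ℝ, 0 < C ∧ ∀ n, ‖qPochhammer a p n‖ ≤ C := by
  obtain ⟨N, hN⟩ : ∃ N : ℕ, ‖a * p ^ N‖ < 1 :=
    ((tendsto_norm_mul_pow hp a).eventually_lt_const one_pos).exists
  have hlim : Tendsto (fun n => qPochhammer a p n) atTop
      (𝓝 (qPochhammer a p N * qPochhammerInf (a * p ^ N) p)) := by
    rw [← tendsto_add_atTop_iff_nat N]
    refine ((tendsto_qPochhammer hN hp).const_mul (qPochhammer a p N)).congr fun n => ?_
    rw [add_comm, qPochhammer_add]
  exact exists_norm_le_of_tendsto hlim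

lemma summable_norm_onePhiOne {a y : ℂ} (hp : ‖p‖ < 1) (hy : ‖y‖ < 1) (hay : ‖a * y‖ < 1) :
    Summable fun i => ‖qFactInv p i * onePhiOneCoeff p a y i‖ := by
  obtain ⟨A, -, hA⟩ := exists_norm_qPochhammer_le hp a
  obtain ⟨B, -, hB⟩ := exists_norm_inv_qPochhammer_le hay hp
  obtain ⟨C, -, hC⟩ := exists_norm_inv_qPochhammer_le hp hp
  refine .of_nonneg_of_le (fun i => norm_nonneg _) (fun i => ?_)
    ((summable_geometric_of_lt_one (norm_nonneg y) hy).mul_left (C * (A * B)))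
  have hpow : ‖p‖ ^ i.choose 2 ≤ 1 := pow_le_one₀ (norm_nonneg p) hp.le
  simp only [onePhiOneCoeff, norm_mul, norm_pow, norm_neg, norm_one, one_pow, one_mul]
  have hA0 := (norm_nonneg _).trans (hA 0)
  have hC0 := (norm_nonneg _).trans (hC 0)
  calc _ ≤ C * (1 * A * B * ‖y‖ ^ i) := by
        gcongr
        exacts [hC i, hA i, hB i]
    _ = _ := by ring

/-- The `₁φ₁` summation formula, the limit of the finite `q`-Chu–Vandermonde sum. -/
lemma hasSum_onePhiOne {a y : ℂ} (hp : ‖p‖ < 1) (hy : ‖y‖ < 1) (hay : ‖a * y‖ < 1) :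
    HasSum (fun i => qFactInv p i * onePhiOneCoeff p a y i)
      (qPochhammerInf y p * (qPochhammerInf (a * y) p)⁻¹) := by
  have hsum := summable_norm_onePhiOne hp hy hay
  have hpartial (n : ℕ) : ∑ i ∈ range (n + 1),
        qPochhammer p p n * qFactInv p (n - i) * (qFactInv p i * onePhiOneCoeff p a y i)
      = qPochhammer y p n * (qPochhammer (a * y) p n)⁻¹ := by
    have hvan := qBinomialSum_onePhiOneCoeff hp y n hay
    rw [qBinomialSum, Nat.sum_antidiagonal_eq_sum_range_succ
      (f := fun i j => qFactInv p i * qFactInv p j * onePhiOneCoeff p a y i)] at hvan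
    rw [← mul_right_inj' (qFactInv_ne_zero hp n), ← mul_assoc, ← hvan, mul_sum]
    have hinv : qFactInv p n * qPochhammer p p n = 1 :=
      inv_mul_cancel₀ (qPochhammer_ne_zero hp hp n)
    refine sum_congr rfl fun i _ => ?_
    linear_combination
      (qFactInv p i * qFactInv p (n - i) * onePhiOneCoeff p a y i) * hinv
  have hlim (i : ℕ) : Tendsto (fun n => qPochhammer p p n * qFactInv p (n - i)) atTop (𝓝 1) := by
    have := (tendsto_qPochhammer hp hp).mul ((tendsto_qFactInv hp).comp (tendsto_sub_atTop_nat i))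
    rwa [mul_inv_cancel₀ (qPochhammerInf_ne_zero p p)] at this
  obtain ⟨A, hA0, hA⟩ := exists_norm_qPochhammer_le hp p
  obtain ⟨B, -, hB⟩ := exists_norm_inv_qPochhammer_le hp hp
  have htannery := tendsto_sum_range_mul hsum (C := A * B) (fun n i => by
    rw [norm_mul]
    exact mul_le_mul (hA n) (hB (n - i)) (norm_nonneg _) hA0.le) hlim
  simp only [hpartial] at htannery
  rw [← tendsto_nhds_unique htannery ((tendsto_qPochhammer hy hp).mul
    ((tendsto_qPochhammer hay hp).inv₀ (qPochhammerInf_ne_zero _ _)))]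
  exact hsum.of_norm.hasSum

lemma hasSum_qPochhammerInf {y : ℂ} (hp : ‖p‖ < 1) (hy : ‖y‖ < 1) :
    HasSum (fun i : ℕ => qFactInv p i * ((-1) ^ i * p ^ i.choose 2 * y ^ i))
      (qPochhammerInf y p) := by
  have h := hasSum_onePhiOne (a := 0) hp hy (by simp)
  simpa [onePhiOneCoeff, qPochhammer_zero_left, qPochhammerInf] using h

end

/-! ### Reduction to a single sum -/

lemma qPochhammer_two_mul (x p : ℂ) (a : ℕ) :
    qPochhammer x p (2 * a) = qPochhammer x (p ^ 2) a * qPochhammer (x * p) (p ^ 2) a := by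
  induction a with
  | zero => simp [qPochhammer_zero]
  | succ a ih =>
    rw [mul_add_one, qPochhammer_succ, qPochhammer_succ, ih, qPochhammer_succ,
      qPochhammer_succ]
    ring

lemma qPochhammer_sq_sq (x p : ℂ) (a : ℕ) :
    qPochhammer (x ^ 2) (p ^ 2) a = qPochhammer x p a * qPochhammer (-x) p a := by
  simp only [qPochhammer, ← prod_mul_distrib]
  exact prod_congr rfl fun i _ => by ring

lemma qPochhammer_neg_mul_qFactInv_sq {p : ℂ} (hp : ‖p‖ < 1) (n : ℕ) :
    qPochhammer (-p) p n * qFactInv (p ^ 2) n = qFactInv p n := by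
  have hne : qPochhammer (-p) p n ≠ 0 := qPochhammer_ne_zero (by rwa [norm_neg]) hp n
  rw [qFactInv, qPochhammer_sq_sq, mul_inv, mul_left_comm, mul_inv_cancel₀ hne, mul_one, qFactInv]

/-- The summand of `R₃⁽³⁾` at the chain `a ≤ b ≤ n`. -/
noncomputable def tripleTerm (q : ℂ) (n b a : ℕ) : ℂ :=
  (-1) ^ n * q ^ (n ^ 2 + 2 * n) * qPochhammer q (q ^ 2) n * (qPochhammer (-q ^ 2) (q ^ 2) n)⁻¹ *
    (qPochhammer (-q ^ 2) (q ^ 2) b * (q ^ 2) ^ (b + 1).choose 2 * qFactInv (q ^ 2) (n - b) *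
      ((-1) ^ a * (q ^ 2) ^ a * qPochhammer (-q ^ 2) (q ^ 2) (2 * a) *
        (qFactInv ((q ^ 2) ^ 2) (b - a) * qFactInv ((q ^ 2) ^ 4) a)))

lemma baileyR3Term_three (q : ℂ) (m : Fin 3 → ℕ) :
    baileyR3Term 3 q m = tripleTerm q (m 2) (m 1) (m 0) := by
  have h3 : chainEntry m 3 = m 2 := rfl
  have h2 : chainEntry m 2 = m 1 := rfl
  have h1 : chainEntry m 1 = m 0 := rfl
  have h0 : chainEntry m 0 = 0 := rfl
  rw [baileyR3Term, baileyB, tripleTerm, Nat.add_one_sub_one, Icc_self, prod_singleton,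
    show Icc 1 3 = {1, 2, 3} from rfl, prod_insert (by simp), prod_insert (by simp), prod_singleton]
  simp only [h1, h2, h3, h0, Nat.reduceSub, Nat.reduceAdd, Nat.reducePow, pow_zero, pow_one,
    one_mul, Nat.sub_zero, div_eq_mul_inv, mul_inv, qFactInv]
  ring

/-- The `n`-th term of `R₃⁽³⁾` after summation over the two inner variables. -/
noncomputable def outerTerm (q : ℂ) (n : ℕ) : ℂ :=
  (-1) ^ n * q ^ (n ^ 2 + 2 * n) * qPochhammer q (q ^ 2) n * (qPochhammer (-q ^ 2) (q ^ 2) n)⁻¹ *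
    ∑ b ∈ range (n + 1), qPochhammer (-q ^ 2) (q ^ 2) b * (q ^ 2) ^ (b + 1).choose 2 *
      qFactInv (q ^ 2) (n - b) * qExpPartial ((q ^ 2) ^ 2) (-q ^ 2) b

lemma sum_range_eq_qExpPartial {p : ℂ} (hp : ‖p‖ < 1) (b : ℕ) :
    ∑ a ∈ range (b + 1), (-1) ^ a * p ^ a * qPochhammer (-p) p (2 * a) *
        (qFactInv (p ^ 2) (b - a) * qFactInv (p ^ 4) a)
      = qExpPartial (p ^ 2) (-p) b := by
  have hp2 : ‖p ^ 2‖ < 1 := norm_pow_succ_lt_one hp 1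
  have hsum := qBinomialSum_eq_qExpPartial (x := -p) (by rwa [neg_sq]) b
  rw [neg_sq] at hsum
  rw [← hsum, qBinomialSum, Nat.sum_antidiagonal_eq_sum_range_succ (f := fun i j =>
    qFactInv (p ^ 2) i * qFactInv (p ^ 2) j * ((-p) ^ i * qPochhammer (-p) (p ^ 2) i))]
  refine sum_congr rfl fun a _ => ?_
  rw [qPochhammer_two_mul, neg_mul, ← sq, ← qPochhammer_neg_mul_qFactInv_sq hp2 a, ← pow_mul,
    neg_pow p a]
  ring

lemma sum_tripleTerm {q : ℂ} (hq : ‖q‖ < 1) (n : ℕ) :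
    ∑ b ∈ range (n + 1), ∑ a ∈ range (b + 1), tripleTerm q n b a = outerTerm q n := by
  simp only [outerTerm, tripleTerm, ← mul_sum,
    sum_range_eq_qExpPartial (norm_pow_succ_lt_one hq 1)]

lemma exists_norm_tripleTerm_le {q : ℂ} (hq : ‖q‖ < 1) :
    ∃ C : ℝ, ∀ n b a, a ≤ b → b ≤ n →
      ‖tripleTerm q n b a‖ ≤ C * (‖q‖ ^ n * (‖q‖ ^ b * ‖q‖ ^ a)) := by
  have hp : ‖q ^ 2‖ < 1 := norm_pow_succ_lt_one hq 1
  have hp2 : ‖(q ^ 2) ^ 2‖ < 1 := norm_pow_succ_lt_one hp 1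
  have hp4 : ‖(q ^ 2) ^ 4‖ < 1 := norm_pow_succ_lt_one hp 3
  obtain ⟨C₁, h₁, hC₁⟩ := exists_norm_qPochhammer_le hp q
  obtain ⟨C₂, h₂, hC₂⟩ := exists_norm_inv_qPochhammer_le (z := -q ^ 2) (by rwa [norm_neg]) hp
  obtain ⟨C₃, h₃, hC₃⟩ := exists_norm_qPochhammer_le hp (-q ^ 2)
  obtain ⟨C₄, h₄, hC₄⟩ := exists_norm_inv_qPochhammer_le hp hp
  obtain ⟨C₅, h₅, hC₅⟩ := exists_norm_inv_qPochhammer_le hp2 hp2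
  obtain ⟨C₆, -, hC₆⟩ := exists_norm_inv_qPochhammer_le hp4 hp4
  refine ⟨C₁ * C₂ * (C₃ * C₄ * (C₃ * (C₅ * C₆))), fun n b a hab hbn => ?_⟩
  have hexp : ‖q‖ ^ (n ^ 2 + 2 * n) ≤ ‖q‖ ^ n * (‖q‖ ^ b * ‖q‖ ^ a) := by
    rw [← pow_add, ← pow_add]
    refine pow_le_pow_of_le_one (norm_nonneg q) hq.le ?_
    have : n ≤ n ^ 2 := Nat.le_self_pow two_ne_zero n
    omega
  have hpow (k : ℕ) : ‖q ^ 2‖ ^ k ≤ 1 := pow_le_one₀ (norm_nonneg _) hp.le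
  rw [tripleTerm]
  simp only [norm_mul, norm_pow (-1 : ℂ), norm_pow q (n ^ 2 + 2 * n), norm_pow (q ^ 2) a,
    norm_pow (q ^ 2) ((b + 1).choose 2), norm_neg (1 : ℂ), norm_one, one_pow, one_mul]
  calc _ ≤ ‖q‖ ^ n * (‖q‖ ^ b * ‖q‖ ^ a) * C₁ * C₂ * (C₃ * 1 * C₄ * (1 * C₃ * (C₅ * C₆))) := by
        gcongr
        exacts [hC₁ _, hC₂ _, hC₃ _, hpow _, hC₄ _, hpow _, hC₃ _, hC₅ _, hC₆ _]
    _ = _ := by ring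

/-- The triples `(n, b, a)` with `a ≤ b ≤ n`, which index the chains of length three by their
largest entry first. -/
def tripleSet : Set (ℕ × ℕ × ℕ) := {x | x.2.2 ≤ x.2.1 ∧ x.2.1 ≤ x.1}

/-- A chain `n₁ ≤ n₂ ≤ n₃`, read as the triple `(n₃, n₂, n₁)`. -/
def chainEquiv : {m : Fin 3 → ℕ // Monotone m} ≃ tripleSet where
  toFun m := ⟨(m.1 2, m.1 1, m.1 0), m.2 (by decide), m.2 (by decide)⟩
  invFun x := ⟨![x.1.2.2, x.1.2.1, x.1.1], Fin.monotone_iff_le_succ.mpr fun i => by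
    fin_cases i
    exacts [x.2.1, x.2.2]⟩
  left_inv m := Subtype.ext (funext fun i => by fin_cases i <;> rfl)
  right_inv _ := rfl

section

variable {q : ℂ}

lemma summable_tripleTerm (hq : ‖q‖ < 1) :
    Summable (tripleSet.indicator fun x => tripleTerm q x.1 x.2.1 x.2.2) := by
  obtain ⟨C, hC⟩ := exists_norm_tripleTerm_le hq
  have hC0 : 0 ≤ C := by simpa using (norm_nonneg _).trans (hC 0 0 0 le_rfl le_rfl)
  have hgeo := summable_geometric_of_lt_one (norm_nonneg q) hq
  have hpow (k : ℕ) : 0 ≤ ‖q‖ ^ k := by positivity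
  have hprod : Summable fun x : ℕ × ℕ × ℕ => ‖q‖ ^ x.1 * (‖q‖ ^ x.2.1 * ‖q‖ ^ x.2.2) :=
    hgeo.mul_of_nonneg (hgeo.mul_of_nonneg hgeo hpow hpow) hpow
      fun x => mul_nonneg (hpow x.1) (hpow x.2)
  refine .of_norm_bounded (hprod.mul_left C) fun x => ?_
  by_cases hx : x ∈ tripleSet
  · rw [Set.indicator_of_mem hx]
    exact hC _ _ _ hx.1 hx.2
  · rw [Set.indicator_of_notMem hx, norm_zero]
    positivity

lemma hasSum_tripleTerm (hq : ‖q‖ < 1) (n : ℕ) :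
    HasSum (fun y : ℕ × ℕ => tripleSet.indicator (fun x => tripleTerm q x.1 x.2.1 x.2.2) (n, y))
      (outerTerm q n) := by
  let s : Finset (ℕ × ℕ) := (range (n + 1) ×ˢ range (n + 1)).filter fun y => y.2 ≤ y.1
  have hs (y : ℕ × ℕ) : y ∈ s ↔ y.1 ∈ range (n + 1) ∧ y.2 ∈ range (y.1 + 1) := by
    simp only [s, mem_filter, mem_product, mem_range]
    omega
  have hmem (y : ℕ × ℕ) : y ∈ s ↔ (n, y) ∈ tripleSet := by
    simp only [hs, tripleSet, Set.mem_ofPred_eq, mem_range]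
    omega
  rw [← sum_tripleTerm hq n, ← sum_finset_product' s _ _ hs,
    sum_congr rfl fun y hy => (Set.indicator_of_mem ((hmem y).mp hy)
      fun x : ℕ × ℕ × ℕ => tripleTerm q x.1 x.2.1 x.2.2).symm]
  exact hasSum_sum_of_ne_finset_zero fun y hy => Set.indicator_of_notMem (mt (hmem y).mpr hy) _

lemma summable_baileyR3Term (hq : ‖q‖ < 1) :
    Summable fun m : {m : Fin 3 → ℕ // Monotone m} => baileyR3Term 3 q m.1 := by
  simp only [baileyR3Term_three]
  exact chainEquiv.summable_iff.mpr (summable_subtype_iff_indicator.mpr (summable_tripleTerm hq))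

lemma hasSum_outerTerm (hq : ‖q‖ < 1) : HasSum (outerTerm q) (baileyR3 3 q) := by
  have hR : baileyR3 3 q = ∑' x, tripleSet.indicator (fun x => tripleTerm q x.1 x.2.1 x.2.2) x := by
    rw [← _root_.tsum_subtype, ← chainEquiv.tsum_eq, baileyR3]
    exact tsum_congr fun m => baileyR3Term_three q m.1
  rw [hR]
  exact (summable_tripleTerm hq).hasSum.prod_fiberwise (hasSum_tripleTerm hq)

end

/-! ### The Hecke-type double sum -/

lemma two_mul_choose_two_add_self (m : ℕ) : 2 * m.choose 2 + m = m ^ 2 := by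
  induction m with
  | zero => rfl
  | succ m ih =>
    rw [Nat.choose_succ_succ' m 1, Nat.choose_one_right]
    linarith

/-- The Bailey coefficients which the Bailey lemma produces from those of
`baileyTransform_heckeCoeff`. -/
noncomputable def baileyAlpha (p : ℂ) (r : ℕ) : ℂ :=
  p ^ (r + 1).choose 2 * ((1 - p ^ (2 * r + 1)) * heckeCoeff p r)

/-- The summand, at `n = r + m`, of the Hecke-type double sum for `R₃⁽³⁾`. -/
noncomputable def doubleTerm (q : ℂ) (r m : ℕ) : ℂ :=
  (-1) ^ (r + m) * q ^ ((r + m) ^ 2 + 2 * (r + m)) * qPochhammer q (q ^ 2) (r + m) *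
    (baileyAlpha (q ^ 2) r * (qFactInv (q ^ 2) m * qFactInv (q ^ 2) (r + m + r + 1)))

lemma doubleTerm_eq_onePhiOne (q : ℂ) (r m : ℕ) :
    doubleTerm q r m = (-1) ^ r * q ^ (r ^ 2 + 2 * r) * qPochhammer q (q ^ 2) r *
      baileyAlpha (q ^ 2) r * qFactInv (q ^ 2) (2 * r + 1) * (qFactInv (q ^ 2) m *
        onePhiOneCoeff (q ^ 2) (q * (q ^ 2) ^ r) (q ^ 3 * (q ^ 2) ^ r) m) := by
  have hexp : q ^ ((r + m) ^ 2 + 2 * (r + m))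
      = q ^ (r ^ 2 + 2 * r) * ((q ^ 2) ^ m.choose 2 * (q ^ 3 * (q ^ 2) ^ r) ^ m) := by
    rw [mul_pow, ← pow_mul, ← pow_mul, ← pow_mul, ← pow_mul, ← pow_add, ← pow_add, ← pow_add]
    congr 1
    linarith [two_mul_choose_two_add_self m]
  have hay : q * (q ^ 2) ^ r * (q ^ 3 * (q ^ 2) ^ r) = (q ^ 2) ^ (2 * r + 1 + 1) := by ring
  rw [doubleTerm, onePhiOneCoeff, hay, hexp, qPochhammer_add,
    show r + m + r + 1 = 2 * r + 1 + m by ring, qFactInv_add _ _ m]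
  ring

/-- The product `(q; q²)_∞ / (q²; q²)_∞`, which governs the size of `R₃⁽³⁾` away from `q = -1`. -/
noncomputable def qPochhammerQuotient (q : ℂ) : ℂ :=
  qPochhammerInf q (q ^ 2) * (qPochhammerInf (q ^ 2) (q ^ 2))⁻¹

lemma norm_heckeCoeff_le {p : ℂ} (hp : ‖p‖ ≤ 1) (r : ℕ) : ‖heckeCoeff p r‖ ≤ 2 * (r + 1) := by
  have hterm (j : ℕ) : ‖alternatingWeight j * p ^ (2 * ((r - j) * (r + j)) + r)‖ ≤ 2 := by
    have hweight : ‖alternatingWeight j‖ ≤ 2 := by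
      rw [alternatingWeight]
      split_ifs <;> simp
    rw [norm_mul, norm_pow]
    exact (mul_le_of_le_one_right (norm_nonneg _) (pow_le_one₀ (norm_nonneg p) hp)).trans hweight
  refine (norm_sum_le_of_le _ fun j _ => hterm j).trans_eq ?_
  simp [mul_comm]

lemma norm_baileyAlpha_le {p : ℂ} (hp : ‖p‖ ≤ 1) (r : ℕ) : ‖baileyAlpha p r‖ ≤ 4 * (r + 1) := by
  have hpow (k : ℕ) : ‖p ^ k‖ ≤ 1 := by
    rw [norm_pow]
    exact pow_le_one₀ (norm_nonneg p) hp
  have hfactor : ‖1 - p ^ (2 * r + 1)‖ ≤ 2 := by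
    refine (norm_sub_le _ _).trans ?_
    linarith [hpow (2 * r + 1), norm_one (α := ℂ)]
  rw [baileyAlpha, norm_mul, norm_mul]
  calc _ ≤ 1 * (2 * (2 * ((r : ℝ) + 1))) := by
        gcongr
        exacts [hpow _, norm_heckeCoeff_le hp r]
    _ = _ := by ring

section

variable {q : ℂ}

lemma outerTerm_eq_sum_antidiagonal (hq : ‖q‖ < 1) (n : ℕ) :
    outerTerm q n = ∑ x ∈ antidiagonal n, doubleTerm q x.1 x.2 := by
  have hp : ‖q ^ 2‖ < 1 := norm_pow_succ_lt_one hq 1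
  have hne : qPochhammer (-q ^ 2) (q ^ 2) n ≠ 0 := qPochhammer_ne_zero (by rwa [norm_neg]) hp n
  simp only [outerTerm, ← baileyTransform_heckeCoeff hp]
  rw [sum_range_mul_baileyTransform hp, mul_assoc _ (_⁻¹), inv_mul_cancel_left₀ hne,
    Nat.sum_antidiagonal_eq_sum_range_succ_mk, baileyTransform, mul_sum]
  refine sum_congr rfl fun r hr => ?_
  rw [doubleTerm, Nat.add_sub_cancel' (mem_range_succ_iff.mp hr), baileyAlpha]

lemma summable_doubleTerm (hq : ‖q‖ < 1) :
    Summable fun x : ℕ × ℕ => doubleTerm q x.1 x.2 := by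
  have hp : ‖q ^ 2‖ < 1 := norm_pow_succ_lt_one hq 1
  obtain ⟨A, hA0, hA⟩ := exists_norm_qPochhammer_le hp q
  obtain ⟨B, hB0, hB⟩ := exists_norm_inv_qPochhammer_le hp hp
  have hgeo := summable_geometric_of_lt_one (norm_nonneg q) hq
  have hlin : Summable fun i : ℕ => ((i + 1).choose 1 * ‖q‖ ^ i : ℝ) :=
    summable_choose_mul_geometric_of_norm_lt_one 1 (by simpa using hq)
  refine .of_norm_bounded ((hlin.mul_of_nonneg hgeo (fun i => by positivity)
    fun i => by positivity).mul_left (A * 4 * B * B)) fun x => ?_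
  have hexp : ‖q‖ ^ ((x.1 + x.2) ^ 2 + 2 * (x.1 + x.2)) ≤ ‖q‖ ^ x.1 * ‖q‖ ^ x.2 := by
    rw [← pow_add]
    exact pow_le_pow_of_le_one (norm_nonneg q) hq.le (by nlinarith)
  simp only [doubleTerm, norm_mul, norm_pow (-1 : ℂ), norm_pow q (_ + _), norm_neg, norm_one,
    one_pow, one_mul, Nat.choose_one_right]
  calc _ ≤ (‖q‖ ^ x.1 * ‖q‖ ^ x.2) * A * ((4 * (x.1 + 1)) * (B * B)) := by
        gcongr
        exacts [hA _, norm_baileyAlpha_le hp.le _, hB _, hB _]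
    _ = _ := by
        push_cast
        ring

lemma hasSum_doubleTerm (hq : ‖q‖ < 1) (r : ℕ) :
    HasSum (doubleTerm q r) (qPochhammerQuotient q *
      ((-1) ^ r * q ^ (r ^ 2 + 2 * r) * baileyAlpha (q ^ 2) r * (1 - q ^ (2 * r + 1))⁻¹)) := by
  obtain ⟨p, hpdef⟩ : ∃ p, p = q ^ 2 := ⟨_, rfl⟩
  have hp : ‖p‖ < 1 := hpdef ▸ norm_pow_succ_lt_one hq 1
  have hy : ‖q ^ 3 * p ^ r‖ < 1 := norm_mul_pow_lt_one (norm_pow_succ_lt_one hq 2) hp r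
  have hay : q * p ^ r * (q ^ 3 * p ^ r) = p ^ (2 * r + 1 + 1) := by
    rw [hpdef]
    ring
  have hsum := (hasSum_onePhiOne hp hy (hay ▸ norm_pow_succ_lt_one hp _)).mul_left
    ((-1) ^ r * q ^ (r ^ 2 + 2 * r) * qPochhammer q p r * baileyAlpha p r * qFactInv p (2 * r + 1))
  have hnum : qPochhammer q p r * ((1 - q ^ (2 * r + 1)) * qPochhammerInf (q ^ 3 * p ^ r) p)
      = qPochhammerInf q p := by
    rw [← qPochhammer_mul_inf hq hp r, qPochhammerInf_eq_mul (norm_mul_pow_lt_one hq hp r) hp,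
      hpdef]
    ring_nf
  have hden : qPochhammer p p (2 * r + 1) * qPochhammerInf (p ^ (2 * r + 1 + 1)) p
      = qPochhammerInf p p := by
    rw [← qPochhammer_mul_inf hp hp (2 * r + 1), pow_succ' p (2 * r + 1)]
  have hne : 1 - q ^ (2 * r + 1) ≠ 0 := one_sub_pow_succ_ne_zero hq _
  have hvalue : qPochhammerQuotient q *
      ((-1) ^ r * q ^ (r ^ 2 + 2 * r) * baileyAlpha p r * (1 - q ^ (2 * r + 1))⁻¹)
        = (-1) ^ r * q ^ (r ^ 2 + 2 * r) * qPochhammer q p r * baileyAlpha p r *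
          qFactInv p (2 * r + 1) * (qPochhammerInf (q ^ 3 * p ^ r) p *
            (qPochhammerInf (q * p ^ r * (q ^ 3 * p ^ r)) p)⁻¹) := by
    rw [qPochhammerQuotient, ← hpdef, ← hnum, ← hden, hay, mul_inv, qFactInv]
    field_simp
  rw [← hpdef, hvalue]
  refine hsum.congr_fun fun m => ?_
  rw [doubleTerm_eq_onePhiOne, ← hpdef]

lemma hasSum_hecke (hq : ‖q‖ < 1) :
    HasSum (fun r : ℕ => qPochhammerQuotient q *
      ((-1) ^ r * q ^ (r ^ 2 + 2 * r) * baileyAlpha (q ^ 2) r * (1 - q ^ (2 * r + 1))⁻¹))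
      (baileyR3 3 q) := by
  have hsum := (summable_doubleTerm hq).hasSum
  have hantidiagonal : HasSum (outerTerm q) (∑' x : ℕ × ℕ, doubleTerm q x.1 x.2) := by
    refine (HasAntidiagonal.sigmaAntidiagonalEquivProd.hasSum_iff.mpr hsum).sigma fun n => ?_
    rw [outerTerm_eq_sum_antidiagonal hq n]
    exact Finset.hasSum (antidiagonal n) fun x => doubleTerm q x.1 x.2
  rw [← (hasSum_outerTerm hq).unique hantidiagonal] at hsum
  exact hsum.prod_fiberwise (hasSum_doubleTerm hq)

lemma norm_baileyR3_le_product (hq : ‖q‖ < 1) :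
    ‖baileyR3 3 q‖ ≤ ‖qPochhammerQuotient q‖ * (4 * (1 - ‖q‖)⁻¹ ^ 3) := by
  have hpos : 0 < 1 - ‖q‖ := sub_pos.mpr hq
  have hlin := ((hasSum_choose_mul_geometric_of_norm_lt_one 1 (r := ‖q‖)
    (by simpa using hq)).mul_left (4 * (1 - ‖q‖)⁻¹)).mul_left ‖qPochhammerQuotient q‖
  refine ((hasSum_hecke hq).norm_le_of_bounded hlin fun r => ?_).trans_eq (by field_simp)
  rw [norm_mul]
  gcongr
  have hexp : ‖q‖ ^ (r ^ 2 + 2 * r) ≤ ‖q‖ ^ r :=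
    pow_le_pow_of_le_one (norm_nonneg q) hq.le (by nlinarith)
  have hp : ‖q ^ 2‖ ≤ 1 := (norm_pow_succ_lt_one hq 1).le
  simp only [norm_mul, norm_pow (-1 : ℂ), norm_pow q (_ + _), norm_neg, norm_one, one_pow, one_mul,
    norm_inv, Nat.choose_one_right]
  calc _ ≤ ‖q‖ ^ r * (4 * (r + 1)) * (1 - ‖q‖)⁻¹ := by
        gcongr
        exacts [norm_baileyAlpha_le hp r, one_sub_norm_le_norm_one_sub_pow hq.le _]
    _ = _ := by
        push_cast
        ring

end

/-! ### Expansion in Gaussian binomials near `q = -1` -/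

/-- The real reciprocal `1 / (ρ; ρ)_m`, which majorizes `qFactInv p m` for `‖p‖ = ρ`. -/
noncomputable def realFactInv (ρ : ℝ) (m : ℕ) : ℝ := ∏ i ∈ range m, (1 - ρ ^ (i + 1))⁻¹

lemma one_sub_pow_succ_pos {ρ : ℝ} (h0 : 0 ≤ ρ) (h1 : ρ < 1) (n : ℕ) : 0 < 1 - ρ ^ (n + 1) :=
  sub_pos.mpr (pow_lt_one₀ h0 h1 n.succ_ne_zero)

lemma realFactInv_pos {ρ : ℝ} (h0 : 0 ≤ ρ) (h1 : ρ < 1) (m : ℕ) : 0 < realFactInv ρ m :=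
  prod_pos fun i _ => inv_pos.mpr (one_sub_pow_succ_pos h0 h1 i)

lemma one_sub_mul_realFactInv_succ {ρ : ℝ} (h0 : 0 ≤ ρ) (h1 : ρ < 1) (m : ℕ) :
    (1 - ρ ^ (m + 1)) * realFactInv ρ (m + 1) = realFactInv ρ m := by
  rw [realFactInv, prod_range_succ, mul_left_comm,
    mul_inv_cancel₀ (one_sub_pow_succ_pos h0 h1 m).ne', mul_one, realFactInv]

lemma one_le_realFactInv {ρ : ℝ} (h0 : 0 ≤ ρ) (h1 : ρ < 1) (m : ℕ) : 1 ≤ realFactInv ρ m :=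
  one_le_prod fun i _ => (one_le_inv₀ (one_sub_pow_succ_pos h0 h1 i)).mpr
    (sub_le_self 1 (pow_nonneg h0 _))

lemma qFactInv_ofReal (ρ : ℝ) (m : ℕ) : qFactInv (ρ : ℂ) m = (realFactInv ρ m : ℂ) := by
  rw [qFactInv, qPochhammer, realFactInv, ← prod_inv_distrib]
  push_cast
  simp only [pow_succ']

lemma norm_qFactInv_le {p : ℂ} (hp : ‖p‖ < 1) (m : ℕ) : ‖qFactInv p m‖ ≤ realFactInv ‖p‖ m := by
  rw [qFactInv, qPochhammer, realFactInv, ← prod_inv_distrib, norm_prod]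
  refine prod_le_prod (fun i _ => norm_nonneg _) fun i _ => ?_
  rw [norm_inv, ← pow_succ']
  refine inv_anti₀ (one_sub_pow_succ_pos (norm_nonneg p) hp i) ?_
  simpa only [norm_one, norm_pow] using norm_sub_norm_le (1 : ℂ) (p ^ (i + 1))

/-- The Gaussian binomial coefficient `[n + N, n]`. -/
noncomputable def gaussBinom (p : ℂ) (n N : ℕ) : ℂ :=
  qPochhammer p p (n + N) * (qFactInv p n * qFactInv p N)

lemma gaussBinom_comm (p : ℂ) (n N : ℕ) : gaussBinom p n N = gaussBinom p N n := by
  rw [gaussBinom, gaussBinom, add_comm n N, mul_comm (qFactInv p n)]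

section

variable {p : ℂ} (hp : ‖p‖ < 1)
include hp

lemma gaussBinom_eq (n N : ℕ) :
    gaussBinom p n N = qFactInv p n * qPochhammer (p ^ (N + 1)) p n := by
  have h : qPochhammer p p N * qFactInv p N = 1 := mul_inv_cancel₀ (qPochhammer_ne_zero hp hp N)
  rw [gaussBinom, add_comm n N, qPochhammer_add, ← pow_succ']
  linear_combination (qFactInv p n * qPochhammer (p ^ (N + 1)) p n) * h

lemma gaussBinom_zero_left (N : ℕ) : gaussBinom p 0 N = 1 := by
  rw [gaussBinom_eq hp, qFactInv_zero, qPochhammer_zero, mul_one]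

lemma gaussBinom_succ_succ (n N : ℕ) :
    gaussBinom p (n + 1) (N + 1)
      = gaussBinom p n (N + 1) + p ^ (n + 1) * gaussBinom p (n + 1) N := by
  rw [gaussBinom, gaussBinom, gaussBinom, show n + 1 + (N + 1) = n + N + 1 + 1 by ring,
    show n + (N + 1) = n + N + 1 by ring, show n + 1 + N = n + N + 1 by ring,
    qPochhammer_succ p p (n + N + 1), ← one_sub_mul_qFactInv_succ hp n,
    ← one_sub_mul_qFactInv_succ hp N]
  ring

lemma norm_gaussBinom_le (n N : ℕ) : ‖gaussBinom p n N‖ ≤ realFactInv ‖p‖ n := by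
  have h0 := norm_nonneg p
  induction n generalizing N with
  | zero => simp [gaussBinom_zero_left hp, realFactInv]
  | succ n ihn =>
    induction N with
    | zero =>
      rw [gaussBinom_comm, gaussBinom_zero_left hp, norm_one]
      exact one_le_realFactInv h0 hp _
    | succ N ihN =>
      rw [gaussBinom_succ_succ hp]
      calc _ ≤ ‖gaussBinom p n (N + 1)‖ + ‖p‖ ^ (n + 1) * ‖gaussBinom p (n + 1) N‖ := by
            simpa only [norm_mul, norm_pow] using
              norm_add_le (gaussBinom p n (N + 1)) (p ^ (n + 1) * gaussBinom p (n + 1) N)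
        _ ≤ realFactInv ‖p‖ n + ‖p‖ ^ (n + 1) * realFactInv ‖p‖ (n + 1) := by
            gcongr
            exact ihn _
        _ = realFactInv ‖p‖ (n + 1) := by
            rw [← one_sub_mul_realFactInv_succ h0 hp n]
            ring

lemma realFactInv_le_inv_pow (a : ℕ) : realFactInv ‖p‖ a ≤ ((1 - ‖p‖)⁻¹) ^ a := by
  rw [realFactInv, ← card_range a, ← prod_const, card_range]
  refine prod_le_prod
    (fun i _ => (inv_pos.mpr (one_sub_pow_succ_pos (norm_nonneg p) hp i)).le) fun i _ => ?_
  exact inv_anti₀ (sub_pos.mpr hp)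
    (sub_le_sub_left (pow_le_of_le_one (norm_nonneg p) hp.le i.succ_ne_zero) 1)

lemma norm_qExpPartial_le {x : ℂ} (hx : ‖x‖ ≤ (1 - ‖p‖) / 2) (b : ℕ) :
    ‖qExpPartial p x b‖ ≤ 2 := by
  have h0 : 0 < 1 - ‖p‖ := sub_pos.mpr hp
  have hterm (a : ℕ) : ‖x ^ a * qFactInv p a‖ ≤ (1 / 2 : ℝ) ^ a :=
    calc _ ≤ ((1 - ‖p‖) / 2) ^ a * ((1 - ‖p‖)⁻¹) ^ a := by
          rw [norm_mul, norm_pow]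
          gcongr
          exact (norm_qFactInv_le hp a).trans (realFactInv_le_inv_pow hp a)
      _ = _ := by
          rw [← mul_pow]
          field_simp
  exact (norm_sum_le_of_le _ fun a _ => hterm a).trans (sum_geometric_two_le _)

lemma gaussBinom_eq_sum (n k : ℕ) :
    gaussBinom p n (2 * k + 1) = ∑ b ∈ range (n + 1), qPochhammer (-p) p b *
      p ^ (b + 1).choose 2 * qFactInv p (n - b) *
        ((-p) ^ b * qFactInv (p ^ 2) b * p ^ (2 * k * b)) := by
  rw [gaussBinom_eq hp, ← qBinomialSum_pow_choose_two hp, qBinomialSum,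
    Nat.sum_antidiagonal_eq_sum_range_succ (f := fun i j => qFactInv p i * qFactInv p j *
      ((-1) ^ i * p ^ i.choose 2 * (p ^ (2 * k + 1 + 1)) ^ i))]
  refine sum_congr rfl fun b _ => ?_
  rw [Nat.choose_succ_succ' b 1, Nat.choose_one_right, neg_pow p b,
    ← qPochhammer_neg_mul_qFactInv_sq hp b]
  ring

end

/-- The product `(-r; r²)_∞ = ∏ (1 + r ^ (2 k + 1))`, the generating function of partitions into
distinct odd parts. -/
noncomputable def distinctOddProduct (r : ℝ) : ℝ := ‖qPochhammerInf (-(r : ℂ)) ((r : ℂ) ^ 2)‖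

lemma distinctOddProduct_nonneg (r : ℝ) : 0 ≤ distinctOddProduct r := norm_nonneg _

lemma norm_qPochhammer_neg_le {p : ℂ} {r : ℝ} (h0 : 0 ≤ r) (h1 : r < 1) (hp : ‖p‖ = r ^ 2) (b : ℕ) :
    ‖qPochhammer (-p) p b‖ ≤ ‖qPochhammer (-(r : ℂ)) ((r : ℂ) ^ 2) b‖ := by
  rw [qPochhammer, qPochhammer, norm_prod, norm_prod]
  refine prod_le_prod (fun i _ => norm_nonneg _) fun i _ => ?_
  have hfactor : ‖1 - -(r : ℂ) * ((r : ℂ) ^ 2) ^ i‖ = 1 + r * (r ^ 2) ^ i := by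
    rw [show 1 - -(r : ℂ) * ((r : ℂ) ^ 2) ^ i = ((1 + r * (r ^ 2) ^ i : ℝ) : ℂ) by
      push_cast; ring, Complex.norm_real, Real.norm_of_nonneg (by positivity)]
  rw [hfactor]
  refine (norm_sub_le _ _).trans ?_
  rw [norm_one, norm_mul, norm_neg, norm_pow, hp]
  gcongr
  nlinarith

section

variable {r : ℝ} (h0 : 0 ≤ r) (h1 : r < 1)
include h0 h1

lemma hasSum_pow_mul_realFactInv (b : ℕ) :
    HasSum (fun i : ℕ => ((r ^ (i ^ 2 + 2 * b * i) * realFactInv (r ^ 2) i : ℝ) : ℂ))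
      (qPochhammerInf (-(r : ℂ) * ((r : ℂ) ^ 2) ^ b) ((r : ℂ) ^ 2)) := by
  have hr : ‖(r : ℂ)‖ < 1 := by rwa [Complex.norm_real, Real.norm_of_nonneg h0]
  have hr2 : ‖(r : ℂ) ^ 2‖ < 1 := norm_pow_succ_lt_one hr 1
  refine (hasSum_qPochhammerInf hr2 (norm_mul_pow_lt_one (by rwa [norm_neg]) hr2 b)).congr_fun ?_
  intro i
  rw [← Complex.ofReal_pow, qFactInv_ofReal, ← two_mul_choose_two_add_self i]
  push_cast
  rw [neg_mul, neg_pow (_ * _) i, mul_pow, ← pow_mul, ← pow_mul, ← pow_mul, pow_add, pow_add]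
  linear_combination (-(realFactInv (r ^ 2) i : ℂ) * (r : ℂ) ^ (2 * i.choose 2) * (r : ℂ) ^ i *
    (r : ℂ) ^ (2 * b * i)) * neg_one_pow_mul_self i

lemma pow_mul_realFactInv_le (b m : ℕ) :
    r ^ (m ^ 2 + 2 * b * m) * realFactInv (r ^ 2) m * ‖qPochhammer (-(r : ℂ)) ((r : ℂ) ^ 2) b‖
      ≤ distinctOddProduct r := by
  have hr : ‖(r : ℂ)‖ < 1 := by rwa [Complex.norm_real, Real.norm_of_nonneg h0]
  have hr2 : ‖(r : ℂ) ^ 2‖ < 1 := norm_pow_succ_lt_one hr 1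
  have hsum := Complex.hasSum_re (hasSum_pow_mul_realFactInv h0 h1 b)
  simp only [Complex.ofReal_re] at hsum
  have hterm : r ^ (m ^ 2 + 2 * b * m) * realFactInv (r ^ 2) m
      ≤ ‖qPochhammerInf (-(r : ℂ) * ((r : ℂ) ^ 2) ^ b) ((r : ℂ) ^ 2)‖ :=
    (le_hasSum hsum m fun j _ => mul_nonneg (by positivity)
      (realFactInv_pos (by positivity) (by nlinarith) j).le).trans (Complex.re_le_norm _)
  calc _ ≤ ‖qPochhammerInf (-(r : ℂ) * ((r : ℂ) ^ 2) ^ b) ((r : ℂ) ^ 2)‖ *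
        ‖qPochhammer (-(r : ℂ)) ((r : ℂ) ^ 2) b‖ := by gcongr
    _ = distinctOddProduct r := by
      rw [distinctOddProduct, ← qPochhammer_mul_inf (z := -(r : ℂ)) (by rwa [norm_neg]) hr2 b,
        norm_mul, mul_comm]

end

/-- The `k`-th term of the expansion of the inner sum of `outerTerm q n` in Gaussian binomials. -/
noncomputable def gaussTerm (q : ℂ) (n k : ℕ) : ℂ :=
  (q ^ 2) ^ (2 * k + 1) * (qPochhammer (-q ^ 2) ((q ^ 2) ^ 2) (k + 1))⁻¹ *
    gaussBinom (q ^ 2) n (2 * k + 1)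

/-- The `b`-th term of what remains of the inner sum of `outerTerm q n` when `N` terms
`gaussTerm q n k` have been split off. -/
noncomputable def remainderTerm (q : ℂ) (n N b : ℕ) : ℂ :=
  (qPochhammer (-q ^ 2) ((q ^ 2) ^ 2) N)⁻¹ *
    (qPochhammer (-q ^ 2) (q ^ 2) b * (q ^ 2) ^ (b + 1).choose 2 * qFactInv (q ^ 2) (n - b) *
      qExpPartial ((q ^ 2) ^ 2) (-(q ^ 2) ^ (2 * N + 1)) b)

section

variable {q : ℂ} (hq : ‖q‖ < 1)
include hq

lemma outerTerm_eq_expansion (n N : ℕ) :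
    outerTerm q n = (-1) ^ n * q ^ (n ^ 2 + 2 * n) *
      (qPochhammer q (q ^ 2) n * (qPochhammer (-q ^ 2) (q ^ 2) n)⁻¹) *
      (∑ k ∈ range N, gaussTerm q n k + ∑ b ∈ range (n + 1), remainderTerm q n N b) := by
  have hp : ‖q ^ 2‖ < 1 := norm_pow_succ_lt_one hq 1
  have hp2 : ‖(q ^ 2) ^ 2‖ < 1 := norm_pow_succ_lt_one hp 1
  rw [outerTerm, mul_assoc _ (qPochhammer q _ n)]
  congr 1
  have hx : -q ^ 2 * ((q ^ 2) ^ 2) ^ N = -(q ^ 2) ^ (2 * N + 1) := by ring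
  simp only [gaussTerm, remainderTerm, gaussBinom_eq_sum hp,
    qExpPartial_expansion hp2 (by rwa [norm_neg] : ‖-q ^ 2‖ < 1) _ N, hx, mul_sum]
  rw [sum_comm, ← sum_add_distrib]
  refine sum_congr rfl fun b _ => ?_
  rw [mul_sub, sub_eq_neg_add, mul_sum, ← sum_neg_distrib]
  congr 1
  · exact sum_congr rfl fun k _ => by ring
  · ring

lemma pow_sq_mul_norm_gaussBinom_le (n k : ℕ) :
    ‖q‖ ^ n ^ 2 * ‖gaussBinom (q ^ 2) n k‖
      ≤ min (distinctOddProduct ‖q‖) (realFactInv (‖q‖ ^ 2) k) := by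
  have hp : ‖q ^ 2‖ < 1 := norm_pow_succ_lt_one hq 1
  have hleft := norm_gaussBinom_le hp n k
  have hright := norm_gaussBinom_le hp k n
  rw [norm_pow] at hleft hright
  refine le_min ?_ ?_
  · have hEuler := pow_mul_realFactInv_le (norm_nonneg q) hq 0 n
    simp only [qPochhammer_zero, norm_one, mul_one, mul_zero, zero_mul, add_zero] at hEuler
    exact le_trans (by gcongr) hEuler
  · rw [gaussBinom_comm]
    exact (mul_le_of_le_one_left (norm_nonneg _) (pow_le_one₀ (norm_nonneg q) hq.le)).trans hright

lemma norm_gaussTerm_le {B : ℝ} {k : ℕ}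
    (hB : ‖(qPochhammer (-q ^ 2) ((q ^ 2) ^ 2) (k + 1))⁻¹‖ *
      min (distinctOddProduct ‖q‖) (realFactInv (‖q‖ ^ 2) (2 * k + 1)) ≤ B) (n : ℕ) :
    ‖q‖ ^ n ^ 2 * ‖gaussTerm q n k‖ ≤ B * ‖q‖ ^ k := by
  have hpow : ‖(q ^ 2) ^ (2 * k + 1)‖ ≤ ‖q‖ ^ k := by
    rw [← pow_mul, norm_pow]
    exact pow_le_pow_of_le_one (norm_nonneg q) hq.le (by lia)
  rw [gaussTerm, norm_mul, norm_mul]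
  calc _ = (‖(qPochhammer (-q ^ 2) ((q ^ 2) ^ 2) (k + 1))⁻¹‖ *
        (‖q‖ ^ n ^ 2 * ‖gaussBinom (q ^ 2) n (2 * k + 1)‖)) * ‖(q ^ 2) ^ (2 * k + 1)‖ := by ring
    _ ≤ B * ‖q‖ ^ k := by
        have hbound := (mul_le_mul_of_nonneg_left (pow_sq_mul_norm_gaussBinom_le hq n (2 * k + 1))
          (norm_nonneg (qPochhammer (-q ^ 2) ((q ^ 2) ^ 2) (k + 1))⁻¹)).trans hB
        exact mul_le_mul hbound hpow (norm_nonneg _) (le_trans (by positivity) hbound)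

lemma norm_remainderTerm_le {B : ℝ} {N : ℕ}
    (hB : ‖(qPochhammer (-q ^ 2) ((q ^ 2) ^ 2) N)⁻¹‖ * distinctOddProduct ‖q‖ ≤ B)
    (hN : ‖q ^ 2‖ ^ (2 * N + 1) ≤ (1 - ‖(q ^ 2) ^ 2‖) / 2) {n b : ℕ} (hb : b ≤ n) :
    ‖q‖ ^ n ^ 2 * ‖remainderTerm q n N b‖ ≤ B * 2 := by
  obtain ⟨m, rfl⟩ := Nat.exists_eq_add_of_le hb
  have hr := norm_nonneg q
  have hp : ‖q ^ 2‖ < 1 := norm_pow_succ_lt_one hq 1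
  have hneg := norm_qPochhammer_neg_le hr hq (norm_pow q 2) b
  have hfact := norm_qFactInv_le hp m
  rw [norm_pow] at hfact
  have hfact0 := (realFactInv_pos (sq_nonneg ‖q‖) (by rwa [← norm_pow]) m).le
  have hpartial := norm_qExpPartial_le (x := -(q ^ 2) ^ (2 * N + 1)) (norm_pow_succ_lt_one hp 1)
    (by rwa [norm_neg, norm_pow]) b
  have hpow : ‖q‖ ^ (b + m) ^ 2 * ‖(q ^ 2) ^ (b + 1).choose 2‖ ≤ ‖q‖ ^ (m ^ 2 + 2 * b * m) := by
    rw [norm_pow, norm_pow, ← pow_mul, ← pow_add]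
    exact pow_le_pow_of_le_one hr hq.le (by nlinarith)
  rw [remainderTerm, Nat.add_sub_cancel_left, norm_mul, norm_mul, norm_mul, norm_mul]
  calc _ = ‖(qPochhammer (-q ^ 2) ((q ^ 2) ^ 2) N)⁻¹‖ *
        ((‖q‖ ^ (b + m) ^ 2 * ‖(q ^ 2) ^ (b + 1).choose 2‖) * ‖qFactInv (q ^ 2) m‖ *
          ‖qPochhammer (-q ^ 2) (q ^ 2) b‖) *
        ‖qExpPartial ((q ^ 2) ^ 2) (-(q ^ 2) ^ (2 * N + 1)) b‖ := by ring
    _ ≤ ‖(qPochhammer (-q ^ 2) ((q ^ 2) ^ 2) N)⁻¹‖ * (‖q‖ ^ (m ^ 2 + 2 * b * m) *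
          realFactInv (‖q‖ ^ 2) m * ‖qPochhammer (-(‖q‖ : ℂ)) ((‖q‖ : ℂ) ^ 2) b‖) * 2 := by gcongr
    _ ≤ ‖(qPochhammer (-q ^ 2) ((q ^ 2) ^ 2) N)⁻¹‖ * distinctOddProduct ‖q‖ * 2 := by
        gcongr
        exact pow_mul_realFactInv_le hr hq b m
    _ ≤ B * 2 := by gcongr

lemma norm_outerTerm_le {A B : ℝ} {n N : ℕ}
    (hA : ‖qPochhammer q (q ^ 2) n * (qPochhammer (-q ^ 2) (q ^ 2) n)⁻¹‖ ≤ A) (hB0 : 0 ≤ B)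
    (hgauss : ∀ k, ‖q‖ ^ n ^ 2 * ‖gaussTerm q n k‖ ≤ B * ‖q‖ ^ k)
    (hrem : ∀ b ≤ n, ‖q‖ ^ n ^ 2 * ‖remainderTerm q n N b‖ ≤ B * 2) :
    ‖outerTerm q n‖ ≤ A * B * (3 * (1 - ‖q‖)⁻¹) * ((n + 1).choose 1 * ‖q‖ ^ n) := by
  have hr := norm_nonneg q
  have hA0 : 0 ≤ A := (norm_nonneg _).trans hA
  have hinv : 1 ≤ (1 - ‖q‖)⁻¹ := (one_le_inv₀ (sub_pos.mpr hq)).mpr (sub_le_self 1 hr)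
  have hgaussSum : ∑ k ∈ range N, ‖q‖ ^ n ^ 2 * ‖gaussTerm q n k‖ ≤ B * (1 - ‖q‖)⁻¹ := by
    refine (sum_le_sum fun k _ => hgauss k).trans ?_
    rw [← mul_sum]
    gcongr
    exact sum_le_hasSum _ (fun i _ => by positivity) (hasSum_geometric_of_lt_one hr hq)
  have hremSum :
      ∑ b ∈ range (n + 1), ‖q‖ ^ n ^ 2 * ‖remainderTerm q n N b‖ ≤ (n + 1) * (B * 2) := by
    refine (sum_le_card_nsmul _ _ _ fun b hb => hrem b (mem_range_succ_iff.mp hb)).trans_eq ?_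
    rw [card_range, nsmul_eq_mul, Nat.cast_add_one]
  have hsum : ‖q‖ ^ n ^ 2 *
      ‖∑ k ∈ range N, gaussTerm q n k + ∑ b ∈ range (n + 1), remainderTerm q n N b‖
        ≤ B * ((n + 1) * (3 * (1 - ‖q‖)⁻¹)) := by
    refine (mul_le_mul_of_nonneg_left ((norm_add_le _ _).trans
      (add_le_add (norm_sum_le _ _) (norm_sum_le _ _))) (by positivity)).trans ?_
    rw [mul_add, mul_sum, mul_sum]
    refine (add_le_add hgaussSum hremSum).trans ?_
    have hn : (0 : ℝ) ≤ n := n.cast_nonneg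
    nlinarith [mul_nonneg hB0 hn, mul_nonneg (mul_nonneg hB0 hn) (sub_nonneg.mpr hinv),
      mul_nonneg hB0 (sub_nonneg.mpr hinv)]
  have hpow : ‖q‖ ^ (2 * n) ≤ ‖q‖ ^ n := pow_le_pow_of_le_one hr hq.le (by lia)
  rw [outerTerm_eq_expansion hq n N, norm_mul, norm_mul, norm_mul, norm_pow (-1 : ℂ), norm_neg,
    norm_one, one_pow, one_mul, norm_pow q, pow_add]
  calc _ = ‖q‖ ^ (2 * n) * ‖qPochhammer q (q ^ 2) n * (qPochhammer (-q ^ 2) (q ^ 2) n)⁻¹‖ *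
        (‖q‖ ^ n ^ 2 *
          ‖∑ k ∈ range N, gaussTerm q n k + ∑ b ∈ range (n + 1), remainderTerm q n N b‖) := by ring
    _ ≤ ‖q‖ ^ n * A * (B * ((n + 1) * (3 * (1 - ‖q‖)⁻¹))) := by gcongr
    _ = _ := by
        rw [Nat.choose_one_right]
        push_cast
        ring

lemma norm_baileyR3_le_expansion {A B : ℝ}
    (hA : ∀ n, ‖qPochhammer q (q ^ 2) n * (qPochhammer (-q ^ 2) (q ^ 2) n)⁻¹‖ ≤ A)
    (hB : ∀ k, ‖(qPochhammer (-q ^ 2) ((q ^ 2) ^ 2) (k + 1))⁻¹‖ *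
      min (distinctOddProduct ‖q‖) (realFactInv (‖q‖ ^ 2) (2 * k + 1)) ≤ B)
    (hB' : ∃ K, ∀ k ≥ K,
      ‖(qPochhammer (-q ^ 2) ((q ^ 2) ^ 2) k)⁻¹‖ * distinctOddProduct ‖q‖ ≤ B) :
    ‖baileyR3 3 q‖ ≤ A * B * (3 * (1 - ‖q‖)⁻¹ ^ 3) := by
  have h0 : 0 < 1 - ‖q‖ := sub_pos.mpr hq
  have hp : ‖q ^ 2‖ < 1 := norm_pow_succ_lt_one hq 1
  obtain ⟨K, hK⟩ := hB'
  have hB0 : 0 ≤ B :=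
    (mul_nonneg (norm_nonneg _) (distinctOddProduct_nonneg _)).trans (hK K le_rfl)
  obtain ⟨N, hKN, hN⟩ : ∃ N, K ≤ N ∧ ‖q ^ 2‖ ^ (2 * N + 1) ≤ (1 - ‖(q ^ 2) ^ 2‖) / 2 := by
    have hlim : Tendsto (fun N : ℕ => ‖q ^ 2‖ ^ (2 * N + 1)) atTop (𝓝 0) :=
      (tendsto_pow_atTop_nhds_zero_of_lt_one (norm_nonneg _) hp).comp
        (tendsto_atTop_mono (fun n => show n ≤ 2 * n + 1 by lia) tendsto_id)
    have hpos : 0 < (1 - ‖(q ^ 2) ^ 2‖) / 2 :=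
      half_pos (sub_pos.mpr (norm_pow_succ_lt_one hp 1))
    exact ((eventually_ge_atTop K).and (hlim.eventually (ge_mem_nhds hpos))).exists
  have hmajorant := (hasSum_choose_mul_geometric_of_norm_lt_one 1 (r := ‖q‖)
    (by simpa using hq)).mul_left (A * B * (3 * (1 - ‖q‖)⁻¹))
  refine ((hasSum_outerTerm hq).norm_le_of_bounded hmajorant fun n => ?_).trans_eq (by field_simp)
  exact norm_outerTerm_le hq (hA n) hB0 (fun k => norm_gaussTerm_le hq (hB k) n)
    fun b => norm_remainderTerm_le hq (hK N hKN) hN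

end

/-! ### Exponential estimates -/

lemma exp_ne_one_of_re_pos {z : ℂ} (hz : 0 < z.re) : Complex.exp z ≠ 1 := by
  intro h
  have hnorm := Complex.norm_exp z
  rw [h, norm_one] at hnorm
  exact (Real.one_lt_exp_iff.mpr hz).ne hnorm

lemma norm_inv_exp_sub_one_sub_inv_le {z : ℂ} (hz0 : z ≠ 0) (hz : ‖z‖ ≤ 1 / 2) :
    ‖(Complex.exp z - 1)⁻¹ - z⁻¹‖ ≤ 2 := by
  have hpos : 0 < ‖z‖ := norm_pos_iff.mpr hz0
  have hquadratic := Complex.norm_exp_sub_one_sub_id_le (x := z) (by linarith)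
  have hlower : ‖z‖ / 2 ≤ ‖Complex.exp z - 1‖ := by
    have h := norm_sub_norm_le z (z - (Complex.exp z - 1))
    rw [sub_sub_cancel, norm_sub_rev z] at h
    nlinarith
  have hne : Complex.exp z - 1 ≠ 0 := norm_pos_iff.mp (by linarith)
  rw [inv_sub_inv hne hz0, norm_div, norm_sub_rev, norm_mul, div_le_iff₀ (by positivity)]
  nlinarith

lemma exp_neg_div_eq {z : ℂ} (h : Complex.exp (2 * z) ≠ 1) :
    Complex.exp (-z) / (1 - Complex.exp (-(2 * z)))
      = (Complex.exp z - 1)⁻¹ - (Complex.exp (2 * z) - 1)⁻¹ := by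
  have hsq : Complex.exp (2 * z) = Complex.exp z ^ 2 := mod_cast Complex.exp_nat_mul z 2
  rw [Complex.exp_neg, Complex.exp_neg, hsq]
  rw [hsq] at h
  have hw : Complex.exp z ≠ 0 := Complex.exp_ne_zero z
  generalize Complex.exp z = w at *
  have hsub : w ^ 2 - 1 ≠ 0 := sub_ne_zero.mpr h
  have hsub' : w - 1 ≠ 0 := fun h0 => hsub (by linear_combination (w + 1) * h0)
  field_simp
  ring

lemma norm_exp_neg_div_sub_le {z : ℂ} (h : 0 < z.re) (hz : ‖z‖ ≤ 1 / 4) :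
    ‖Complex.exp (-z) / (1 - Complex.exp (-(2 * z))) - (2 * z)⁻¹‖ ≤ 4 := by
  have hz0 : z ≠ 0 := by
    rintro rfl
    exact h.ne' Complex.zero_re
  have hnorm : ‖2 * z‖ ≤ 1 / 2 := by
    rw [norm_mul, Complex.norm_ofNat]
    linarith
  have hz1 := norm_inv_exp_sub_one_sub_inv_le hz0 (by linarith)
  have hz2 := norm_inv_exp_sub_one_sub_inv_le (mul_ne_zero two_ne_zero hz0) hnorm
  rw [exp_neg_div_eq (exp_ne_one_of_re_pos (by simpa using h)),
    show (Complex.exp z - 1)⁻¹ - (Complex.exp (2 * z) - 1)⁻¹ - (2 * z)⁻¹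
      = ((Complex.exp z - 1)⁻¹ - z⁻¹) - ((Complex.exp (2 * z) - 1)⁻¹ - (2 * z)⁻¹) by
        field_simp
        ring]
  exact (norm_sub_le _ _).trans (by linarith)

lemma exp_neg_mul_exp (a : ℝ) : Real.exp (-a) * Real.exp a = 1 := by
  rw [← Real.exp_add, neg_add_cancel, Real.exp_zero]

lemma exp_neg_div_one_sub_le {a : ℝ} (ha : 0 < a) :
    Real.exp (-a) / (1 - Real.exp (-(2 * a))) ≤ (2 * a)⁻¹ := by
  have hsinh : a ≤ Real.sinh a := Real.self_le_sinh_iff.mpr ha.le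
  rw [Real.sinh_eq] at hsinh
  have hlt : Real.exp (-(2 * a)) < 1 := Real.exp_lt_one_iff.mpr (by linarith)
  have hsq : Real.exp (-(2 * a)) = Real.exp (-a) * Real.exp (-a) := by
    rw [← Real.exp_add]
    ring_nf
  rw [div_le_iff₀ (by linarith), inv_mul_eq_div, le_div_iff₀ (by linarith), hsq]
  nlinarith [Real.exp_pos (-a), exp_neg_mul_exp a]

lemma norm_exp_neg_div_le {z : ℂ} (h : 0 < z.re) :
    ‖Complex.exp (-z) / (1 - Complex.exp (-(2 * z)))‖ ≤ (2 * z.re)⁻¹ := by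
  refine le_trans ?_ (exp_neg_div_one_sub_le h)
  have hden : 1 - Real.exp (-(2 * z.re)) ≤ ‖1 - Complex.exp (-(2 * z))‖ := by
    simpa [Complex.norm_exp] using norm_sub_norm_le (1 : ℂ) (Complex.exp (-(2 * z)))
  rw [norm_div, Complex.norm_exp, Complex.neg_re]
  exact div_le_div_of_nonneg_left (Real.exp_pos _).le
    (sub_pos.mpr (Real.exp_lt_one_iff.mpr (by linarith))) hden

lemma exp_neg_div_one_sub_exp_neg_le {a : ℝ} (ha : 0 < a) :
    Real.exp (-a) / (1 - Real.exp (-a)) ≤ a⁻¹ := by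
  have hlt : Real.exp (-a) < 1 := Real.exp_lt_one_iff.mpr (by linarith)
  rw [div_le_iff₀ (by linarith), inv_mul_eq_div, le_div_iff₀ ha]
  nlinarith [Real.exp_pos (-a), exp_neg_mul_exp a, Real.add_one_le_exp a]

lemma half_le_one_sub_exp_neg {a : ℝ} (h0 : 0 ≤ a) (h1 : a ≤ 1) : a / 2 ≤ 1 - Real.exp (-a) := by
  have hquadratic := Real.quadratic_le_exp_of_nonneg h0
  have hinv : Real.exp (-a) ≤ (1 + a + a ^ 2 / 2)⁻¹ := by
    rw [Real.exp_neg]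
    exact inv_anti₀ (by positivity) hquadratic
  have hbound : (1 + a + a ^ 2 / 2)⁻¹ ≤ 1 - a / 2 := by
    rw [inv_le_iff_one_le_mul₀ (by positivity)]
    nlinarith [mul_nonneg h0 (sub_nonneg.mpr h1), mul_nonneg (sq_nonneg a) (sub_nonneg.mpr h1)]
  linarith

/-! ### Sums of inverse squares -/

lemma hasSum_inv_sq : HasSum (fun m : ℕ => 1 / ((m : ℝ) + 1) ^ 2) (Real.pi ^ 2 / 6) := by
  simpa using (hasSum_nat_add_iff' 1).mpr hasSum_zeta_two

lemma hasSum_inv_sq_dvd {d : ℕ} (hd : 0 < d) :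
    HasSum (fun m : ℕ => if d ∣ m + 1 then 1 / ((m : ℝ) + 1) ^ 2 else 0)
      (Real.pi ^ 2 / 6 / d ^ 2) := by
  have hpred (k : ℕ) : d * (k + 1) - 1 + 1 = d * (k + 1) :=
    Nat.sub_add_cancel (Nat.mul_pos hd k.succ_pos)
  have hinj : Function.Injective fun k : ℕ => d * (k + 1) - 1 := fun a b h => by
    have := (hpred a).symm.trans ((congrArg (· + 1) h).trans (hpred b))
    exact Nat.succ_injective (Nat.eq_of_mul_eq_mul_left hd this)
  rw [← hinj.hasSum_iff]
  · refine (hasSum_inv_sq.div_const ((d : ℝ) ^ 2)).congr_fun fun k => ?_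
    have hcast : ((d * (k + 1) - 1 : ℕ) : ℝ) + 1 = d * (k + 1) := mod_cast hpred k
    simp only [Function.comp_apply, hpred, hcast, dvd_mul_right, if_true]
    field_simp
  · refine fun m hm => if_neg ?_
    rintro ⟨_ | k, hk⟩
    · simp at hk
    · exact hm ⟨k, by lia⟩

lemma hasSum_inv_sq_odd :
    HasSum (fun m : ℕ => if 2 ∣ m + 1 then 0 else 1 / ((m : ℝ) + 1) ^ 2) (Real.pi ^ 2 / 8) := by
  rw [show Real.pi ^ 2 / 8 = Real.pi ^ 2 / 6 - Real.pi ^ 2 / 6 / (2 : ℕ) ^ 2 by push_cast; ring]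
  refine (hasSum_inv_sq.sub (hasSum_inv_sq_dvd two_pos)).congr_fun fun m => ?_
  split_ifs <;> simp

lemma hasSum_inv_sq_two_mod_four :
    HasSum (fun m : ℕ => if (m + 1) % 4 = 2 then 1 / ((m : ℝ) + 1) ^ 2 else 0)
      (Real.pi ^ 2 / 32) := by
  rw [show Real.pi ^ 2 / 32 = Real.pi ^ 2 / 6 / (2 : ℕ) ^ 2 - Real.pi ^ 2 / 6 / (4 : ℕ) ^ 2 by
    push_cast; ring]
  refine ((hasSum_inv_sq_dvd two_pos).sub (hasSum_inv_sq_dvd four_pos)).congr_fun fun m => ?_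
  by_cases htwo : (m + 1) % 4 = 2
  · rw [if_pos htwo, if_pos (by lia), if_neg (by lia), sub_zero]
  · by_cases hfour : 4 ∣ m + 1
    · rw [if_neg htwo, if_pos (by lia), if_pos hfour, sub_self]
    · rw [if_neg htwo, if_neg (by lia), if_neg hfour, sub_self]

lemma hasSum_alternating_inv_sq :
    HasSum (fun m : ℕ => (-1) ^ m / ((m : ℝ) + 1) ^ 2) (Real.pi ^ 2 / 12) := by
  rw [show Real.pi ^ 2 / 12 = Real.pi ^ 2 / 6 - 2 * (Real.pi ^ 2 / 6 / (2 : ℕ) ^ 2) by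
    push_cast; ring]
  refine (hasSum_inv_sq.sub ((hasSum_inv_sq_dvd two_pos).mul_left 2)).congr_fun fun m => ?_
  rcases m.even_or_odd with hm | hm
  · rw [hm.neg_one_pow, if_neg (by grind), mul_zero, sub_zero]
  · rw [hm.neg_one_pow, if_pos (by grind)]
    ring

lemma hasSum_inv_sq_tail (L : ℕ) :
    HasSum (fun m : ℕ => if L ≤ m then 1 / ((m : ℝ) + 1) ^ 2 else 0)
      (Real.pi ^ 2 / 6 - ∑ m ∈ range L, 1 / ((m : ℝ) + 1) ^ 2) := by
  have hhead : HasSum (fun m : ℕ => if m ∈ range L then 1 / ((m : ℝ) + 1) ^ 2 else 0)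
      (∑ m ∈ range L, 1 / ((m : ℝ) + 1) ^ 2) := by
    rw [← sum_congr rfl fun m (hm : m ∈ range L) => if_pos hm]
    exact hasSum_sum_of_ne_finset_zero fun m hm => if_neg hm
  refine (hasSum_inv_sq.sub hhead).congr_fun fun m => ?_
  simp only [mem_range, ← not_le, ite_not]
  split_ifs <;> simp

lemma exists_inv_sq_tail_le {ε : ℝ} (hε : 0 < ε) :
    ∃ L : ℕ, ∃ s ≤ ε, HasSum (fun m : ℕ => if L ≤ m then 1 / ((m : ℝ) + 1) ^ 2 else 0) s := by
  have hlim := hasSum_inv_sq.tendsto_sum_nat.const_sub (Real.pi ^ 2 / 6)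
  rw [sub_self] at hlim
  obtain ⟨L, hL⟩ := (hlim.eventually (ge_mem_nhds hε)).exists
  exact ⟨L, _, hL, hasSum_inv_sq_tail L⟩

lemma hasSum_initial_segment (L : ℕ) (C : ℝ) :
    HasSum (fun m : ℕ => if m < L then C else 0) (L * C) := by
  have hsum : ∑ m ∈ range L, (if m < L then C else 0) = L * C := by
    rw [sum_congr rfl fun m hm => if_pos (mem_range.mp hm), sum_const, card_range, nsmul_eq_mul]
  exact hsum ▸ hasSum_sum_of_ne_finset_zero fun m hm => if_neg (by simpa using hm)

/-! ### The infinite product away from `q = -1` -/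

/-- The point `-e^(-t + iφ)`, polar coordinates on the punctured unit disc centred at the critical
direction `q = -1`. -/
noncomputable def negNome (t φ : ℝ) : ℂ := -Complex.exp (-(t : ℂ) + φ * Complex.I)

lemma norm_negNome (t φ : ℝ) : ‖negNome t φ‖ = Real.exp (-t) := by
  rw [negNome, norm_neg, Complex.norm_exp]
  simp

lemma norm_negNome_lt_one {t : ℝ} (ht : 0 < t) (φ : ℝ) : ‖negNome t φ‖ < 1 := by
  rw [norm_negNome, Real.exp_lt_one_iff]
  linarith

lemma norm_negNome_pow (t φ : ℝ) (M : ℕ) : ‖negNome t φ ^ M‖ = Real.exp (-(M * t)) := by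
  rw [norm_pow, norm_negNome, ← Real.exp_nat_mul, mul_neg]

lemma negNome_pow (t φ : ℝ) (M : ℕ) :
    negNome t φ ^ M = (-1) ^ M * Complex.exp (-(M * ((t : ℂ) - φ * Complex.I))) := by
  rw [negNome, neg_pow, ← Complex.exp_nat_mul]
  congr 2
  ring

lemma negNome_pow_re (t φ : ℝ) (M : ℕ) :
    (negNome t φ ^ M).re = (-1) ^ M * (Real.exp (-(M * t)) * Real.cos (M * φ)) := by
  have hsign : (-1 : ℂ) ^ M = (((-1 : ℝ) ^ M : ℝ) : ℂ) := by push_cast; rfl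
  have harg : -((M : ℂ) * ((t : ℂ) - φ * Complex.I))
      = ((-(M * t) : ℝ) : ℂ) + ((M * φ : ℝ) : ℂ) * Complex.I := by push_cast; ring
  rw [negNome_pow, hsign, Complex.re_ofReal_mul, harg, Complex.exp_re]
  simp

/-- The real part of a term in the logarithm of `(q; q²)_∞ / (q²; q²)_∞`. -/
noncomputable def logQuotientTerm (q : ℂ) (m : ℕ) : ℝ :=
  (-(q ^ (m + 1) / ((m + 1) * (1 + q ^ (m + 1))))).re

lemma hasSum_logQuotientTerm {q : ℂ} (hq : ‖q‖ < 1) :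
    HasSum (logQuotientTerm q)
      (-∑' m : ℕ, q ^ (m + 1) / ((m + 1) * (1 - (q ^ 2) ^ (m + 1))) +
        ∑' m : ℕ, (q ^ 2) ^ (m + 1) / ((m + 1) * (1 - (q ^ 2) ^ (m + 1)))).re := by
  have hp : ‖q ^ 2‖ < 1 := norm_pow_succ_lt_one hq 1
  refine Complex.hasSum_re (((summable_logTerm hq hp).hasSum.neg.add
    (summable_logTerm hp hp).hasSum).congr_fun fun m => ?_)
  have hsub : 1 - q ^ (m + 1) ≠ 0 := one_sub_pow_succ_ne_zero hq m
  have hadd : 1 + q ^ (m + 1) ≠ 0 := by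
    simpa using one_sub_pow_succ_ne_zero
      ((norm_neg (q ^ (m + 1))).trans_lt (norm_pow_succ_lt_one hq m)) 0
  have hm : (m : ℂ) + 1 ≠ 0 := Nat.cast_add_one_ne_zero m
  have hfactor : 1 - (q ^ 2) ^ (m + 1) = (1 - q ^ (m + 1)) * (1 + q ^ (m + 1)) := by
    rw [pow_right_comm]
    ring
  rw [hfactor, pow_right_comm]
  field_simp
  ring

lemma norm_qPochhammerQuotient_eq {q : ℂ} (hq : ‖q‖ < 1) :
    ‖qPochhammerQuotient q‖ = Real.exp (∑' m, logQuotientTerm q m) := by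
  rw [(hasSum_logQuotientTerm hq).tsum_eq, qPochhammerQuotient, qPochhammerInf, qPochhammerInf,
    ← Complex.exp_neg, neg_neg, ← Complex.exp_add, Complex.norm_exp]

lemma norm_qPochhammerQuotient_le_exp {q : ℂ} (hq : ‖q‖ < 1) {c : ℕ → ℝ} {x S C : ℝ} {L : ℕ}
    (hc : HasSum c S) (h : ∀ m, logQuotientTerm q m ≤ c m * x + if m < L then C else 0) :
    ‖qPochhammerQuotient q‖ ≤ Real.exp (S * x + L * C) := by
  rw [norm_qPochhammerQuotient_eq hq, Real.exp_le_exp]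
  exact hasSum_le h (hasSum_logQuotientTerm hq).summable.hasSum
    ((hc.mul_right x).add (hasSum_initial_segment L C))

lemma logQuotientTerm_le_norm (q : ℂ) (m : ℕ) :
    logQuotientTerm q m ≤ ‖q ^ (m + 1)‖ / ((m + 1) * ‖1 + q ^ (m + 1)‖) := by
  refine (Complex.re_le_norm _).trans_eq ?_
  rw [norm_neg, norm_div, norm_mul, norm_natCast_add_one]

lemma logQuotientTerm_le_inv_sq {t : ℝ} (ht : 0 < t) (φ : ℝ) (m : ℕ) :
    logQuotientTerm (negNome t φ) m ≤ 1 / ((m : ℝ) + 1) ^ 2 * t⁻¹ := by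
  refine (logQuotientTerm_le_norm _ m).trans ?_
  have hmt : 0 < ((m + 1 : ℕ) : ℝ) * t := by positivity
  have hden := norm_sub_norm_le (1 : ℂ) (-negNome t φ ^ (m + 1))
  rw [norm_neg, norm_one, sub_neg_eq_add] at hden
  rw [norm_negNome_pow] at hden ⊢
  have hlt : Real.exp (-((m + 1 : ℕ) * t)) < 1 := Real.exp_lt_one_iff.mpr (by linarith)
  calc _ ≤ Real.exp (-((m + 1 : ℕ) * t)) / ((m + 1) * (1 - Real.exp (-((m + 1 : ℕ) * t)))) := by
        gcongr
    _ = 1 / (m + 1) * (Real.exp (-((m + 1 : ℕ) * t)) / (1 - Real.exp (-((m + 1 : ℕ) * t)))) := by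
        rw [div_mul_div_comm, one_mul]
    _ ≤ 1 / (m + 1) * ((m + 1 : ℕ) * t)⁻¹ := by
        gcongr
        exact exp_neg_div_one_sub_exp_neg_le hmt
    _ = _ := by
        push_cast
        field_simp

lemma logQuotientTerm_le_of_cos {t φ κ : ℝ} (ht : 0 < t) (hκ : 0 < κ) (hκ1 : κ ≤ 1) {m : ℕ}
    (h : -(1 - κ) ≤ (-1) ^ (m + 1) * Real.cos ((m + 1 : ℕ) * φ)) :
    logQuotientTerm (negNome t φ) m ≤ κ⁻¹ := by
  refine (logQuotientTerm_le_norm _ m).trans ?_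
  have hm : (1 : ℝ) ≤ m + 1 := by simp
  have hnum : ‖negNome t φ ^ (m + 1)‖ ≤ 1 := (norm_pow_succ_lt_one (norm_negNome_lt_one ht φ) m).le
  have hden : κ ≤ ‖1 + negNome t φ ^ (m + 1)‖ := by
    refine le_trans ?_ (Complex.re_le_norm _)
    have hexp : Real.exp (-((m + 1 : ℕ) * t)) ≤ 1 :=
      Real.exp_le_one_iff.mpr (neg_nonpos.mpr (by positivity))
    rw [Complex.add_re, Complex.one_re, negNome_pow_re, mul_left_comm]
    nlinarith [Real.exp_pos (-((m + 1 : ℕ) * t))]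
  calc _ ≤ 1 / (1 * κ) := by gcongr
    _ = _ := by rw [one_mul, one_div]

lemma logQuotientTerm_eq_of_odd {t φ : ℝ} (ht : 0 < t) {m : ℕ} (hm : Odd (m + 1)) :
    logQuotientTerm (negNome t φ) m = ((m : ℝ) + 1)⁻¹ *
      (Complex.exp ((m + 1 : ℕ) * ((t : ℂ) - φ * Complex.I)) - 1)⁻¹.re := by
  have hre : 0 < (((m + 1 : ℕ) : ℂ) * ((t : ℂ) - φ * Complex.I)).re := by
    rw [← Complex.ofReal_natCast, Complex.re_ofReal_mul]
    simp only [Complex.sub_re, Complex.ofReal_re, Complex.re_ofReal_mul, Complex.I_re]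
    rw [mul_zero, sub_zero]
    positivity
  have hne := sub_ne_zero.mpr (exp_ne_one_of_re_pos hre)
  have hw := Complex.exp_ne_zero (((m + 1 : ℕ) : ℂ) * ((t : ℂ) - φ * Complex.I))
  have hcast : (m : ℂ) + 1 ≠ 0 := Nat.cast_add_one_ne_zero m
  rw [logQuotientTerm, negNome_pow, hm.neg_one_pow, Complex.exp_neg, ← Complex.re_ofReal_mul]
  congr 1
  generalize Complex.exp (((m + 1 : ℕ) : ℂ) * ((t : ℂ) - φ * Complex.I)) = w at *
  have hden : 1 + -1 * w⁻¹ = (w - 1) / w := by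
    field_simp
    ring
  rw [hden]
  push_cast
  field_simp

lemma re_inv_ofReal_sub_mul_I_le {t φ : ℝ} (ht : 0 < t) (h : 3 / 2 * t ≤ |φ|) :
    ((t : ℂ) - φ * Complex.I)⁻¹.re ≤ 4 / 13 * t⁻¹ := by
  have hsq : (3 / 2 * t) ^ 2 ≤ φ ^ 2 := sq_abs φ ▸ pow_le_pow_left₀ (by positivity) h 2
  have hnormSq : Complex.normSq ((t : ℂ) - φ * Complex.I) = t ^ 2 + φ ^ 2 := by
    rw [Complex.normSq_apply]
    simp only [Complex.sub_re, Complex.sub_im, Complex.mul_re, Complex.mul_im, Complex.ofReal_re,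
      Complex.ofReal_im, Complex.I_re, Complex.I_im]
    ring
  have hre : ((t : ℂ) - φ * Complex.I).re = t := by simp
  rw [Complex.inv_re, hnormSq, hre, div_le_iff₀ (by positivity)]
  calc t = 4 / 13 * t⁻¹ * (t ^ 2 + (3 / 2 * t) ^ 2) := by
        field_simp
        ring
    _ ≤ _ := by gcongr

lemma logQuotientTerm_le_of_odd {t φ : ℝ} (ht : 0 < t) {m : ℕ} (hm : Odd (m + 1))
    (hmφ : ((m + 1 : ℕ) : ℝ) * |φ| ≤ 1 / 4) (hφ : 3 / 2 * t ≤ |φ|) :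
    logQuotientTerm (negNome t φ) m ≤ 4 / 13 * (1 / ((m : ℝ) + 1) ^ 2) * t⁻¹ + 2 := by
  rw [logQuotientTerm_eq_of_odd ht hm]
  have hre := re_inv_ofReal_sub_mul_I_le ht hφ
  have hne : (t : ℂ) - φ * Complex.I ≠ 0 := fun h => ht.ne' (by simpa using congrArg Complex.re h)
  have hnorm : ‖(t : ℂ) - φ * Complex.I‖ ≤ t + |φ| := by
    simpa [abs_of_pos ht] using norm_sub_le (t : ℂ) (φ * Complex.I)
  generalize (t : ℂ) - φ * Complex.I = τ at *
  have hpole : ((((m + 1 : ℕ) : ℂ) * τ)⁻¹).re ≤ ((m : ℝ) + 1)⁻¹ * (4 / 13 * t⁻¹) := by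
    rw [mul_inv, ← Complex.ofReal_natCast, ← Complex.ofReal_inv, Complex.re_ofReal_mul]
    push_cast
    gcongr
  have hmτ : ‖((m + 1 : ℕ) : ℂ) * τ‖ ≤ 1 / 2 := by
    rw [norm_mul, Complex.norm_natCast]
    nlinarith
  have hdiff := (Complex.re_le_norm _).trans
    (norm_inv_exp_sub_one_sub_inv_le (mul_ne_zero (Nat.cast_ne_zero.mpr m.succ_ne_zero) hne) hmτ)
  rw [Complex.sub_re] at hdiff
  have hinv : ((m : ℝ) + 1)⁻¹ ≤ 1 := inv_le_one_of_one_le₀ (by simp)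
  calc _ ≤ ((m : ℝ) + 1)⁻¹ * (((m : ℝ) + 1)⁻¹ * (4 / 13 * t⁻¹) + 2) := by
        gcongr
        linarith
    _ = 4 / 13 * (1 / ((m : ℝ) + 1) ^ 2) * t⁻¹ + ((m : ℝ) + 1)⁻¹ * 2 := by field_simp
    _ ≤ _ := by linarith

lemma norm_qPochhammerQuotient_le_near {L : ℕ} {s t φ : ℝ}
    (hs : HasSum (fun m : ℕ => if L ≤ m then 1 / ((m : ℝ) + 1) ^ 2 else 0) s) (ht : 0 < t)
    (hLφ : (L : ℝ) * |φ| ≤ 1 / 4) (hφ : 3 / 2 * t ≤ |φ|) :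
    ‖qPochhammerQuotient (negNome t φ)‖
      ≤ Real.exp ((4 / 13 * (Real.pi ^ 2 / 8) + s) * t⁻¹ + L * 2) := by
  refine norm_qPochhammerQuotient_le_exp (norm_negNome_lt_one ht φ)
    ((hasSum_inv_sq_odd.mul_left (4 / 13)).add hs) fun m => ?_
  rcases lt_or_ge m L with hm | hm
  · have hmL : ((m + 1 : ℕ) : ℝ) ≤ L := Nat.cast_le.mpr hm
    have hmφ : ((m + 1 : ℕ) : ℝ) * |φ| ≤ 1 / 4 := le_trans (by gcongr) hLφ
    rw [if_neg hm.not_ge, if_pos hm, add_zero]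
    by_cases heven : 2 ∣ m + 1
    · rw [if_pos heven, mul_zero, zero_mul, zero_add]
      refine (logQuotientTerm_le_of_cos ht one_pos le_rfl ?_).trans (by norm_num)
      rw [(even_iff_two_dvd.mpr heven).neg_one_pow, one_mul, sub_self, neg_zero]
      rw [← Nat.abs_cast, ← abs_mul, abs_le] at hmφ
      exact Real.cos_nonneg_of_mem_Icc
        ⟨by linarith [Real.pi_gt_three], by linarith [Real.pi_gt_three]⟩
    · rw [if_neg heven]
      exact logQuotientTerm_le_of_odd ht (Nat.not_even_iff_odd.mp (mt even_iff_two_dvd.mp heven))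
        hmφ hφ
  · rw [if_pos hm, if_neg hm.not_gt, add_zero]
    refine (logQuotientTerm_le_inv_sq ht φ m).trans ?_
    gcongr
    refine le_add_of_nonneg_left (mul_nonneg (by norm_num) ?_)
    split_ifs <;> positivity

lemma abs_cos_odd_mul_pi_div_two_add_le {M : ℕ} (hM : Odd M) (x : ℝ) :
    |Real.cos (M * (Real.pi / 2) + x)| ≤ |x| := by
  obtain ⟨k, rfl⟩ := hM
  have hcos : Real.cos ((2 * k + 1 : ℕ) * (Real.pi / 2)) = 0 := by
    rw [Real.cos_eq_zero_iff]
    exact ⟨k, by push_cast; ring⟩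
  rw [Real.cos_add, hcos, zero_mul, zero_sub, abs_neg, abs_mul]
  calc _ ≤ 1 * |x| :=
        mul_le_mul (Real.abs_sin_le_one _) Real.abs_sin_le_abs (abs_nonneg _) zero_le_one
    _ = _ := one_mul _

lemma neg_half_le_neg_one_pow_mul_cos {M : ℕ} (hM : M % 4 ≠ 2) {φ : ℝ}
    (h : (M : ℝ) * |(|φ| - Real.pi / 2)| ≤ 1 / 4) :
    -(1 / 2) ≤ (-1) ^ M * Real.cos (M * φ) := by
  obtain ⟨ψ, hψ⟩ : ∃ ψ, ψ = |φ| - Real.pi / 2 := ⟨_, rfl⟩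
  have hcos : Real.cos (M * φ) = Real.cos (M * (Real.pi / 2) + M * ψ) := by
    rw [← Real.cos_abs, abs_mul, Nat.abs_cast, hψ]
    ring_nf
  rw [← hψ, ← Nat.abs_cast, ← abs_mul] at h
  rw [hcos]
  rcases M.even_or_odd with heven | hodd
  · obtain ⟨k, rfl⟩ : 4 ∣ M := by grind
    rw [heven.neg_one_pow, one_mul,
      show ((4 * k : ℕ) : ℝ) * (Real.pi / 2) + (4 * k : ℕ) * ψ
        = (4 * k : ℕ) * ψ + k * (2 * Real.pi) by push_cast; ring, Real.cos_add_nat_mul_two_pi]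
    rw [abs_le] at h
    nlinarith [Real.one_sub_sq_div_two_le_cos (x := ((4 * k : ℕ) : ℝ) * ψ)]
  · have habs := (abs_cos_odd_mul_pi_div_two_add_le hodd (M * ψ)).trans h
    rw [hodd.neg_one_pow]
    linarith [(abs_le.mp habs).2]

/-- Near `q = ±i` only the exponents `m + 1 ≡ 2 (mod 4)` have `q^(m+1)` close to `-1`. -/
lemma norm_qPochhammerQuotient_le_quarter {L : ℕ} {s t φ : ℝ}
    (hs : HasSum (fun m : ℕ => if L ≤ m then 1 / ((m : ℝ) + 1) ^ 2 else 0) s) (ht : 0 < t)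
    (hφ : (L : ℝ) * |(|φ| - Real.pi / 2)| ≤ 1 / 4) :
    ‖qPochhammerQuotient (negNome t φ)‖ ≤ Real.exp ((Real.pi ^ 2 / 32 + s) * t⁻¹ + L * 2) := by
  refine norm_qPochhammerQuotient_le_exp (norm_negNome_lt_one ht φ)
    (hasSum_inv_sq_two_mod_four.add hs) fun m => ?_
  rcases lt_or_ge m L with hm | hm
  · have hmL : ((m + 1 : ℕ) : ℝ) ≤ L := Nat.cast_le.mpr hm
    rw [if_neg hm.not_ge, if_pos hm, add_zero]
    by_cases hmod : (m + 1) % 4 = 2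
    · rw [if_pos hmod]
      exact (logQuotientTerm_le_inv_sq ht φ m).trans (by linarith)
    · rw [if_neg hmod, zero_mul, zero_add]
      have hcos := neg_half_le_neg_one_pow_mul_cos hmod (le_trans (by gcongr) hφ)
      exact (logQuotientTerm_le_of_cos (κ := 1 / 2) ht (by norm_num) (by norm_num)
        (by linarith)).trans (by norm_num)
  · rw [if_pos hm, if_neg hm.not_gt, add_zero]
    refine (logQuotientTerm_le_inv_sq ht φ m).trans ?_
    gcongr
    refine le_add_of_nonneg_left ?_
    split_ifs <;> positivity

lemma cos_two_mul_le_neg_cos {η φ : ℝ} (hη : 0 ≤ η) (hφ : |φ| ≤ Real.pi)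
    (h : η ≤ |(|φ| - Real.pi / 2)|) : -Real.cos η ≤ Real.cos (2 * φ) := by
  have hcos : Real.cos (2 * φ) = -Real.cos (|2 * (|φ| - Real.pi / 2)|) := by
    rw [Real.cos_abs, show 2 * (|φ| - Real.pi / 2) = 2 * |φ| - Real.pi by ring,
      Real.cos_sub_pi, neg_neg, ← Real.cos_abs (2 * φ), abs_mul, abs_two]
  have hupper : |2 * (|φ| - Real.pi / 2)| ≤ Real.pi :=
    abs_le.mpr ⟨by linarith [abs_nonneg φ], by linarith⟩
  rw [hcos, neg_le_neg_iff]
  refine Real.cos_le_cos_of_nonneg_of_le_pi hη hupper ?_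
  rw [abs_mul, abs_two]
  linarith

/-- Away from `-1` and `±i` the first two terms of the logarithm stay bounded. -/
lemma norm_qPochhammerQuotient_le_far {η t φ : ℝ} (hη : 0 < η) (hη1 : η ≤ 1) (ht : 0 < t)
    (hπ : |φ| ≤ Real.pi) (hφ : η ≤ |φ|) (hφ' : η ≤ |(|φ| - Real.pi / 2)|) :
    ‖qPochhammerQuotient (negNome t φ)‖
      ≤ Real.exp ((Real.pi ^ 2 / 6 - 5 / 4) * t⁻¹ + 2 * (1 - Real.cos η)⁻¹) := by
  have hcos0 : 0 < Real.cos η := Real.cos_pos_of_le_one (abs_le.mpr ⟨by linarith, hη1⟩)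
  have hcos1 : Real.cos η < 1 := Real.cos_zero ▸
    Real.cos_lt_cos_of_nonneg_of_le_pi le_rfl (by linarith [Real.pi_gt_three]) hη
  have htail := hasSum_inv_sq_tail 2
  rw [show ∑ m ∈ range 2, 1 / ((m : ℝ) + 1) ^ 2 = 5 / 4 by
    rw [sum_range_succ, sum_range_one]; norm_num] at htail
  refine norm_qPochhammerQuotient_le_exp (L := 2) (norm_negNome_lt_one ht φ) htail fun m => ?_
  rcases lt_or_ge m 2 with hm | hm
  · rw [if_neg hm.not_ge, if_pos hm, zero_mul, zero_add]
    refine logQuotientTerm_le_of_cos ht (by linarith) (by linarith) ?_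
    rw [sub_sub_cancel]
    interval_cases m
    · norm_num
      rw [← Real.cos_abs φ]
      exact Real.cos_le_cos_of_nonneg_of_le_pi hη.le hπ hφ
    · norm_num
      exact cos_two_mul_le_neg_cos hη.le hπ hφ'
  · rw [if_pos hm, if_neg hm.not_gt, add_zero]
    exact logQuotientTerm_le_inv_sq ht φ m

/-- The rates `4/13 · π²/8`, `π²/32` and `π²/6 - 5/4` of the three regions `φ` near `0`, `|φ|` near
`π/2` and the rest are all smaller than `π²/24`. -/
lemma exists_norm_qPochhammerQuotient_le :
    ∃ A < Real.pi ^ 2 / 24, ∃ C : ℝ, ∀ t φ : ℝ, 0 < t → |φ| ≤ Real.pi → 3 / 2 * t ≤ |φ| →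
      ‖qPochhammerQuotient (negNome t φ)‖ ≤ Real.exp (A * t⁻¹ + C) := by
  obtain ⟨L, s, hs, hsum⟩ := exists_inv_sq_tail_le (show (0 : ℝ) < 1 / 100 by norm_num)
  have hpi := Real.pi_gt_d2
  have hpi' := Real.pi_lt_d2
  obtain ⟨η, hη0, hη1, hLη⟩ : ∃ η : ℝ, 0 < η ∧ η ≤ 1 ∧ (L : ℝ) * η ≤ 1 / 4 := by
    refine ⟨1 / (4 * (L + 1)), by positivity, ?_, ?_⟩
    · rw [div_le_one (by positivity)]
      linarith [(L.cast_nonneg : (0 : ℝ) ≤ L)]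
    · rw [mul_one_div, div_le_div_iff₀ (by positivity) (by norm_num)]
      linarith
  have hκ : 0 ≤ (1 - Real.cos η)⁻¹ := inv_nonneg.mpr (sub_nonneg.mpr (Real.cos_le_one η))
  refine ⟨Real.pi ^ 2 / 24 - 1 / 1000, by linarith, L * 2 + 2 * (1 - Real.cos η)⁻¹,
    fun t φ ht hπ hφ => ?_⟩
  rcases le_total |φ| η with hnear | hnear
  · refine (norm_qPochhammerQuotient_le_near hsum ht (le_trans (by gcongr) hLη) hφ).trans
      (Real.exp_le_exp.mpr ?_)
    gcongr
    · nlinarith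
    · linarith
  rcases le_total |(|φ| - Real.pi / 2)| η with hquarter | hquarter
  · refine (norm_qPochhammerQuotient_le_quarter hsum ht (le_trans (by gcongr) hLη)).trans
      (Real.exp_le_exp.mpr ?_)
    gcongr
    · nlinarith
    · linarith
  · refine (norm_qPochhammerQuotient_le_far hη0 hη1 ht hπ hnear hquarter).trans
      (Real.exp_le_exp.mpr ?_)
    have hrate : Real.pi ^ 2 / 6 - 5 / 4 ≤ Real.pi ^ 2 / 24 - 1 / 1000 := by nlinarith
    gcongr
    · linarith [(L.cast_nonneg : (0 : ℝ) ≤ L)]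

/-! ### Products in a sector at `q = -1` -/

lemma realFactInv_le_pow_div_factorial {t : ℝ} (ht : 0 < t) {M : ℕ} (hM : 2 * t * M ≤ 1) :
    realFactInv (Real.exp (-(2 * t))) M ≤ t⁻¹ ^ M / M.factorial := by
  have hfact : t⁻¹ ^ M / M.factorial = ∏ i ∈ range M, (t * (i + 1 : ℕ))⁻¹ := by
    simp_rw [mul_inv]
    rw [prod_mul_distrib, prod_const, card_range, prod_inv_distrib, ← Nat.cast_prod,
      prod_range_add_one_eq_factorial, div_eq_mul_inv]
  have hfactor (i : ℕ) (hi : i ∈ range M) :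
      t * (i + 1 : ℕ) ≤ 1 - Real.exp (-(2 * t)) ^ (i + 1) := by
    have hiM : ((i + 1 : ℕ) : ℝ) ≤ M := mod_cast mem_range.mp hi
    have hhalf := half_le_one_sub_exp_neg (a := 2 * t * (i + 1 : ℕ)) (by positivity)
      (le_trans (by gcongr) hM)
    rw [← Real.exp_nat_mul, mul_neg, mul_comm _ (2 * t)]
    linarith
  rw [hfact, realFactInv]
  exact prod_le_prod
    (fun i hi => inv_nonneg.mpr (le_trans (by positivity) (hfactor i hi)))
    fun i hi => inv_anti₀ (by positivity) (hfactor i hi)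

lemma realFactInv_le_exp {t : ℝ} (ht : 0 < t) {M : ℕ} (hM : 2 * t * M ≤ 1) :
    realFactInv (Real.exp (-(2 * t))) M ≤ Real.exp (t⁻¹ / 10 + 3 * M) := by
  have hten : (10 : ℝ) ≤ Real.exp 3 := by
    rw [show (3 : ℝ) = 1 + 1 + 1 by norm_num, Real.exp_add, Real.exp_add]
    nlinarith [Real.exp_one_gt_d9]
  calc _ ≤ t⁻¹ ^ M / M.factorial := realFactInv_le_pow_div_factorial ht hM
    _ = (t⁻¹ / 10) ^ M / M.factorial * 10 ^ M := by
        rw [div_pow]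
        field_simp
    _ ≤ Real.exp (t⁻¹ / 10) * Real.exp 3 ^ M := by
        gcongr
        exact Real.pow_div_factorial_le_exp _ (by positivity) M
    _ = _ := by rw [← Real.exp_nat_mul, ← Real.exp_add, mul_comm (M : ℝ)]

lemma norm_one_sub_negNome_ge (x y : ℝ) :
    1 + Real.exp (-x) * Real.cos y ≤ ‖1 - negNome x y‖ := by
  refine le_of_eq_of_le ?_ (Complex.re_le_norm _)
  simp [negNome, Complex.exp_re]

lemma exp_le_norm_one_sub_negNome {x y : ℝ} (hx : x ≤ 1) (h : |y| ≤ 3 / 2 * x) :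
    Real.exp (1 / 100) ≤ ‖1 - negNome x y‖ := by
  have hpi := Real.pi_gt_d2
  have hcos : 0.04 ≤ Real.cos y := by
    have hlower := Real.one_sub_mul_le_cos (abs_nonneg y) (by linarith)
    rw [Real.cos_abs] at hlower
    have hslope : 2 / Real.pi * |y| ≤ 0.96 := by
      rw [div_mul_eq_mul_div, div_le_iff₀ Real.pi_pos]
      nlinarith
    linarith
  have hexp : 0.36 ≤ Real.exp (-x) := by
    linarith [Real.exp_neg_one_gt_d9, Real.exp_le_exp.mpr (neg_le_neg hx)]
  have hsmall : Real.exp (1 / 100) ≤ 1.0144 := by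
    nlinarith [Real.add_one_le_exp (-(1 / 100) : ℝ), exp_neg_mul_exp (1 / 100),
      Real.exp_pos (1 / 100)]
  nlinarith [norm_one_sub_negNome_ge x y]

lemma half_le_norm_one_sub_negNome {x y : ℝ} (h : |y| ≤ 3 / 2 * x) :
    1 / 2 ≤ ‖1 - negNome x y‖ := by
  rcases le_total x 1 with hx | hx
  · have hone := Real.one_le_exp (show (0 : ℝ) ≤ 1 / 100 by norm_num)
    linarith [exp_le_norm_one_sub_negNome hx h]
  · have hnorm := norm_sub_norm_le 1 (negNome x y)
    rw [norm_one, norm_negNome] at hnorm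
    linarith [Real.exp_neg_one_lt_d9, Real.exp_le_exp.mpr (neg_le_neg hx)]

lemma negNome_sq_pow (t φ : ℝ) (n : ℕ) :
    (negNome t φ ^ 2) ^ n = -negNome (2 * n * t) (2 * n * φ) := by
  rw [negNome, negNome, neg_neg, neg_sq, ← pow_mul, ← Complex.exp_nat_mul]
  push_cast
  ring_nf

lemma abs_two_mul_natCast_mul_le {t φ : ℝ} (hφ : |φ| ≤ 3 / 2 * t) (n : ℕ) :
    |2 * n * φ| ≤ 3 / 2 * (2 * n * t) := by
  rw [abs_mul, abs_of_nonneg (by positivity), mul_left_comm]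
  gcongr

lemma norm_one_add_negNome_le {t φ : ℝ} (ht : 0 < t) (ht1 : t ≤ 1 / 4) (hφ : |φ| ≤ 3 / 2 * t) :
    ‖1 + negNome t φ‖ ≤ 5 * t := by
  have hnorm : ‖-(t : ℂ) + φ * Complex.I‖ ≤ 5 / 2 * t := by
    refine (norm_add_le _ _).trans ?_
    simp only [norm_neg, norm_mul, Complex.norm_real, Real.norm_eq_abs, Complex.norm_I, mul_one,
      abs_of_pos ht]
    linarith
  have hexp := Complex.norm_exp_sub_one_le (x := -(t : ℂ) + φ * Complex.I) (by linarith)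
  rw [negNome, ← sub_eq_add_neg, norm_sub_rev]
  linarith

/-- The numerator and denominator differ by `q(1 + q)q^(2i)`, and `1 + q` is small. -/
lemma norm_one_sub_mul_inv_le {t φ : ℝ} (ht : 0 < t) (ht1 : t ≤ 1 / 4) (hφ : |φ| ≤ 3 / 2 * t)
    (i : ℕ) : ‖(1 - negNome t φ * (negNome t φ ^ 2) ^ i) *
      (1 - -negNome t φ ^ 2 * (negNome t φ ^ 2) ^ i)⁻¹‖
        ≤ Real.exp (10 * t * ‖negNome t φ ^ 2‖ ^ i) := by
  have hhalf : 1 / 2 ≤ ‖1 + (negNome t φ ^ 2) ^ (i + 1)‖ := by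
    rw [negNome_sq_pow, ← sub_eq_add_neg]
    exact half_le_norm_one_sub_negNome (abs_two_mul_natCast_mul_le hφ _)
  have hsmall := norm_one_add_negNome_le ht ht1 hφ
  have hq := (norm_negNome_lt_one ht φ).le
  generalize negNome t φ = q at *
  have hne : 1 + (q ^ 2) ^ (i + 1) ≠ 0 := norm_pos_iff.mp (by linarith)
  have hsplit : (1 - q * (q ^ 2) ^ i) * (1 - -q ^ 2 * (q ^ 2) ^ i)⁻¹
      = 1 - q * (1 + q) * (q ^ 2) ^ i * (1 + (q ^ 2) ^ (i + 1))⁻¹ := by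
    rw [show 1 - -q ^ 2 * (q ^ 2) ^ i = 1 + (q ^ 2) ^ (i + 1) by ring]
    field_simp
    ring
  have hinv : ‖(1 + (q ^ 2) ^ (i + 1))⁻¹‖ ≤ 2 := by
    rw [norm_inv, inv_le_comm₀ (by linarith) (by norm_num)]
    linarith
  have hdiff : ‖q * (1 + q) * (q ^ 2) ^ i * (1 + (q ^ 2) ^ (i + 1))⁻¹‖
      ≤ 10 * t * ‖q ^ 2‖ ^ i := by
    rw [norm_mul, norm_mul, norm_mul, norm_pow (q ^ 2)]
    calc _ ≤ 1 * (5 * t) * ‖q ^ 2‖ ^ i * 2 := by gcongr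
      _ = _ := by ring
  rw [hsplit]
  refine (norm_sub_le _ _).trans ?_
  rw [norm_one]
  linarith [Real.add_one_le_exp (10 * t * ‖q ^ 2‖ ^ i)]

lemma norm_qPochhammer_ratio_le {t φ : ℝ} (ht : 0 < t) (ht1 : t ≤ 1 / 4) (hφ : |φ| ≤ 3 / 2 * t)
    (n : ℕ) : ‖qPochhammer (negNome t φ) (negNome t φ ^ 2) n *
      (qPochhammer (-negNome t φ ^ 2) (negNome t φ ^ 2) n)⁻¹‖ ≤ Real.exp 10 := by
  have hp : ‖negNome t φ ^ 2‖ < 1 := norm_pow_succ_lt_one (norm_negNome_lt_one ht φ) 1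
  rw [qPochhammer, qPochhammer, ← prod_inv_distrib, ← prod_mul_distrib, norm_prod]
  refine (prod_le_prod (fun _ _ => norm_nonneg _)
    fun i _ => norm_one_sub_mul_inv_le ht ht1 hφ i).trans ?_
  rw [← Real.exp_sum, ← mul_sum, Real.exp_le_exp]
  have hgeom : ∑ i ∈ range n, ‖negNome t φ ^ 2‖ ^ i ≤ (1 - ‖negNome t φ ^ 2‖)⁻¹ :=
    sum_le_hasSum _ (fun i _ => by positivity) (hasSum_geometric_of_lt_one (norm_nonneg _) hp)
  have hgap : t ≤ 1 - ‖negNome t φ ^ 2‖ := by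
    have := half_le_one_sub_exp_neg (a := (2 : ℕ) * t) (by positivity) (by push_cast; linarith)
    rw [norm_negNome_pow]
    push_cast at this ⊢
    linarith
  calc _ ≤ 10 * t * t⁻¹ := by
        gcongr
        exact hgeom.trans (inv_anti₀ ht hgap)
    _ = 10 := by field_simp

lemma exp_le_norm_qPochhammer_of_mul_le {t φ : ℝ} (ht : 0 < t) (hφ : |φ| ≤ 3 / 2 * t) {k : ℕ}
    (hk : (k : ℝ) * t ≤ 1 / 4) :
    Real.exp (k / 100) ≤ ‖qPochhammer (-negNome t φ ^ 2) ((negNome t φ ^ 2) ^ 2) k‖ := by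
  rw [qPochhammer, norm_prod, div_eq_mul_one_div, Real.exp_nat_mul]
  nth_rw 1 [← card_range k]
  rw [← prod_const]
  refine prod_le_prod (fun _ _ => (Real.exp_pos _).le) fun i hi => ?_
  have hik : ((2 * i + 1 : ℕ) : ℝ) ≤ 2 * k := by
    have := mem_range.mp hi
    exact_mod_cast (show 2 * i + 1 ≤ 2 * k by lia)
  rw [show 1 - -negNome t φ ^ 2 * ((negNome t φ ^ 2) ^ 2) ^ i
    = 1 + (negNome t φ ^ 2) ^ (2 * i + 1) by ring, negNome_sq_pow, ← sub_eq_add_neg]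
  exact exp_le_norm_one_sub_negNome (by nlinarith) (abs_two_mul_natCast_mul_le hφ _)

/-! ### Logarithms of products near `q = -1` -/

lemma norm_mul_exp_neg_div_sub_le {σ c : ℂ} {K : ℝ} {L m : ℕ} (hσ : 0 < σ.re)
    (hc : ‖c‖ ≤ K / (m + 1)) (hL : L * ‖σ‖ ≤ 1 / 4) :
    ‖c * (Complex.exp (-((m + 1 : ℕ) * σ)) / (1 - Complex.exp (-(2 * ((m + 1 : ℕ) * σ)))))
        - c * (2 * ((m + 1 : ℕ) * σ))⁻¹‖
      ≤ K * ((if L ≤ m then 1 / ((m : ℝ) + 1) ^ 2 else 0) * σ.re⁻¹ + if m < L then 4 else 0) := by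
  have hre : (((m + 1 : ℕ) : ℂ) * σ).re = (m + 1) * σ.re := by
    rw [← Complex.ofReal_natCast, Complex.re_ofReal_mul]
    push_cast
    rfl
  have hz : 0 < (((m + 1 : ℕ) : ℂ) * σ).re := by
    rw [hre]
    positivity
  have hK : 0 ≤ K / (m + 1) := (norm_nonneg c).trans hc
  rw [← mul_sub, norm_mul]
  rcases lt_or_ge m L with hm | hm
  · rw [if_pos hm, if_neg hm.not_ge, zero_mul, zero_add]
    have hnorm : ‖((m + 1 : ℕ) : ℂ) * σ‖ ≤ 1 / 4 := by
      rw [norm_mul, Complex.norm_natCast]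
      refine le_trans ?_ hL
      gcongr
      exact hm
    have hK0 : 0 ≤ K := by simpa using (le_div_iff₀ (by positivity)).mp hK
    have hK' : K / (m + 1) ≤ K :=
      div_le_self hK0 (by linarith [(m.cast_nonneg : (0 : ℝ) ≤ m)])
    exact mul_le_mul (hc.trans hK') (norm_exp_neg_div_sub_le hz hnorm) (norm_nonneg _)
      hK0
  · rw [if_pos hm, if_neg hm.not_gt, add_zero]
    have hinv : ‖(2 * (((m + 1 : ℕ) : ℂ) * σ))⁻¹‖ ≤ (2 * (((m + 1 : ℕ) : ℂ) * σ).re)⁻¹ := by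
      rw [norm_inv, norm_mul, Complex.norm_ofNat]
      gcongr
      exact Complex.re_le_norm _
    have hdiff := (norm_sub_le _ _).trans (add_le_add (norm_exp_neg_div_le hz) hinv)
    rw [hre] at hdiff
    calc _ ≤ K / (m + 1) * _ := mul_le_mul hc hdiff (norm_nonneg _) hK
      _ = _ := by
          field_simp
          norm_num

/-- Replacing `1 / (2 sinh z)` by `1 / (2z)` costs a bounded amount in each of the first `L` terms,
and a multiple of `1 / ((m + 1)² Re σ)` in each of the others. -/
lemma norm_sub_mul_inv_le_of_hasSum {σ S S' : ℂ} {c : ℕ → ℂ} {K s : ℝ} {L : ℕ} (hσ : 0 < σ.re)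
    (hc : ∀ m : ℕ, ‖c m‖ ≤ K / (m + 1)) (hL : L * ‖σ‖ ≤ 1 / 4)
    (hs : HasSum (fun m : ℕ => if L ≤ m then 1 / ((m : ℝ) + 1) ^ 2 else 0) s)
    (hS : HasSum (fun m : ℕ => c m *
      (Complex.exp (-((m + 1 : ℕ) * σ)) / (1 - Complex.exp (-(2 * ((m + 1 : ℕ) * σ)))))) S)
    (hS' : HasSum (fun m : ℕ => c m / (m + 1)) S') :
    ‖S - S' * (2 * σ)⁻¹‖ ≤ K * (s * σ.re⁻¹ + L * 4) := by
  refine (hS.sub (hS'.mul_right _)).norm_le_of_bounded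
    (((hs.mul_right _).add (hasSum_initial_segment L 4)).mul_left K) fun m => ?_
  rw [show c m / (m + 1) * (2 * σ)⁻¹ = c m * (2 * ((m + 1 : ℕ) * σ))⁻¹ by
    push_cast
    rw [mul_left_comm 2, mul_inv (m + 1 : ℂ), div_eq_mul_inv, mul_assoc]]
  exact norm_mul_exp_neg_div_sub_le hσ (hc m) hL

lemma neg_logTerm_exp_neg (σ b : ℂ) (m : ℕ) :
    -((-Complex.exp (-σ)) ^ (m + 1) * b / ((m + 1) * (1 - (Complex.exp (-σ) ^ 2) ^ (m + 1))))
      = (-1) ^ m / (m + 1) * b *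
        (Complex.exp (-((m + 1 : ℕ) * σ)) / (1 - Complex.exp (-(2 * ((m + 1 : ℕ) * σ))))) := by
  have hexp (n : ℕ) : Complex.exp (-(n * σ)) = Complex.exp (-σ) ^ n := by
    rw [← mul_neg, Complex.exp_nat_mul]
  have hsq : Complex.exp (-(2 * ((m + 1 : ℕ) * σ))) = (Complex.exp (-σ) ^ 2) ^ (m + 1) := by
    rw [← pow_mul, ← hexp]
    push_cast
    ring_nf
  rw [hexp, hsq, neg_pow, pow_succ (-1 : ℂ), div_mul_eq_mul_div, div_mul_div_comm, ← neg_div]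
  ring_nf

lemma hasSum_alternating_inv_sq_complex :
    HasSum (fun m : ℕ => (-1 : ℂ) ^ m / (m + 1) / (m + 1)) ((Real.pi ^ 2 / 12 : ℝ) : ℂ) := by
  refine (Complex.hasSum_ofReal.mpr hasSum_alternating_inv_sq).congr_fun fun m => ?_
  push_cast
  rw [div_div, sq]

lemma distinctOddProduct_exp_neg_le {L : ℕ} {s t : ℝ}
    (hs : HasSum (fun m : ℕ => if L ≤ m then 1 / ((m : ℝ) + 1) ^ 2 else 0) s) (ht : 0 < t)
    (hL : L * t ≤ 1 / 4) :
    distinctOddProduct (Real.exp (-t)) ≤ Real.exp ((Real.pi ^ 2 / 24 + s) * t⁻¹ + L * 4) := by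
  have hexp : ((Real.exp (-t) : ℝ) : ℂ) = Complex.exp (-t) := by push_cast; rfl
  have hq : ‖Complex.exp (-t)‖ < 1 := by
    rw [← hexp, Complex.norm_real, Real.norm_of_nonneg (Real.exp_pos _).le]
    exact Real.exp_lt_one_iff.mpr (by linarith)
  have hsum := (summable_logTerm (z := -Complex.exp (-t)) (by rwa [norm_neg])
    (norm_pow_succ_lt_one hq 1)).hasSum.neg
  rw [distinctOddProduct, hexp, qPochhammerInf, Complex.norm_exp, Real.exp_le_exp]
  have hclose := norm_sub_mul_inv_le_of_hasSum (σ := t) (K := 1)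
    (c := fun m => (-1) ^ m / (m + 1)) (by simpa using ht)
    (fun m => by simp [norm_natCast_add_one]) (by simpa [abs_of_pos ht] using hL) hs
    (hsum.congr_fun fun m => by simpa only [mul_one] using (neg_logTerm_exp_neg t 1 m).symm)
    hasSum_alternating_inv_sq_complex
  have hre := (Complex.re_le_norm _).trans hclose
  rw [Complex.sub_re, show ((Real.pi ^ 2 / 12 : ℝ) : ℂ) * (2 * (t : ℂ))⁻¹
    = ((Real.pi ^ 2 / 24 * t⁻¹ : ℝ) : ℂ) by push_cast; ring, Complex.ofReal_re,
    Complex.ofReal_re] at hre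
  linarith

/-- A majorant of `c ^ (m + 1) / (m + 1) ^ 2` whose sum over `m` is elementary: the first two terms
are exact and the others geometric. -/
noncomputable def dilogMajorant (c : ℝ) (m : ℕ) : ℝ :=
  1 / 9 * c ^ (m + 1) + (if m = 0 then 8 / 9 * c else 0) + (if m = 1 then 5 / 36 * c ^ 2 else 0)

lemma pow_div_sq_le_dilogMajorant {c : ℝ} (hc : 0 ≤ c) (m : ℕ) :
    c ^ (m + 1) / ((m : ℝ) + 1) ^ 2 ≤ dilogMajorant c m := by
  rw [dilogMajorant]
  match m with
  | 0 => norm_num; linarith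
  | 1 => norm_num; linarith
  | m + 2 =>
    rw [if_neg (by lia), if_neg (by lia), add_zero, add_zero, div_eq_inv_mul, ← one_div]
    gcongr
    push_cast
    nlinarith [(m.cast_nonneg : (0 : ℝ) ≤ m)]

lemma hasSum_dilogMajorant {c : ℝ} (h0 : 0 ≤ c) (h1 : c < 1) :
    HasSum (dilogMajorant c) (1 / 9 * (c * (1 - c)⁻¹) + 8 / 9 * c + 5 / 36 * c ^ 2) := by
  have hgeom := ((hasSum_geometric_of_lt_one h0 h1).mul_left c).mul_left (1 / 9)
  refine ((hgeom.add (hasSum_ite_eq 0 (8 / 9 * c))).add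
    (hasSum_ite_eq 1 (5 / 36 * c ^ 2))).congr_fun fun m => ?_
  rw [dilogMajorant, pow_succ']

lemma exists_hasSum_alternating_dilog {w : ℂ} (hw : ‖w‖ ≤ 0.37) :
    ∃ D : ℂ, ‖D‖ ≤ 0.4133 ∧
      HasSum (fun m : ℕ => (-1) ^ m / ((m : ℂ) + 1) * w ^ (m + 1) / (m + 1)) D := by
  have hmajorant := hasSum_dilogMajorant (c := 0.37) (by norm_num) (by norm_num)
  have hbound (m : ℕ) :
      ‖(-1) ^ m / ((m : ℂ) + 1) * w ^ (m + 1) / (m + 1)‖ ≤ dilogMajorant 0.37 m := by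
    refine le_trans ?_ (pow_div_sq_le_dilogMajorant (by norm_num) m)
    rw [norm_div, norm_mul, norm_div, norm_natCast_add_one, norm_pow, norm_neg, norm_one, one_pow,
      one_div_mul_eq_div, div_div, ← sq, norm_pow]
    gcongr
  have hsum := (hmajorant.summable.of_norm_bounded hbound).hasSum
  exact ⟨_, (hsum.norm_le_of_bounded hmajorant hbound).trans (by norm_num), hsum⟩

lemma hasSum_log_qPochhammer {x P : ℂ} (hx : ‖x‖ < 1) (hP : ‖P‖ < 1) (k : ℕ) :
    ∃ S : ℂ, ‖qPochhammer x P k‖ = Real.exp S.re ∧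
      HasSum (fun m : ℕ => -(x ^ (m + 1) * (1 - (P ^ k) ^ (m + 1)) /
        ((m + 1) * (1 - P ^ (m + 1))))) S := by
  have hxk := norm_mul_pow_lt_one hx hP k
  have hsum := (summable_logTerm hx hP).hasSum.neg.add (summable_logTerm hxk hP).hasSum
  refine ⟨_, ?_, hsum.congr_fun fun m => ?_⟩
  · rw [eq_div_of_mul_eq (qPochhammerInf_ne_zero _ _) (qPochhammer_mul_inf hx hP k),
      qPochhammerInf, qPochhammerInf, ← Complex.exp_sub, Complex.norm_exp, sub_neg_eq_add]
  · rw [mul_pow]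
    ring

/-- The logarithm is `(π² / 12 - D) / 4τ` up to a controlled error, where `τ = t - iφ` and `D` is a
dilogarithm value at a point of modulus at most `e⁻¹`. -/
lemma exists_log_qPochhammer_sub_le {L : ℕ} {s t φ : ℝ}
    (hs : HasSum (fun m : ℕ => if L ≤ m then 1 / ((m : ℝ) + 1) ^ 2 else 0) s) (ht : 0 < t)
    (hL : L * ‖2 * ((t : ℂ) - φ * Complex.I)‖ ≤ 1 / 4) {k : ℕ} (hk : 1 / 4 ≤ k * t) :
    ∃ S D : ℂ, ‖qPochhammer (-negNome t φ ^ 2) ((negNome t φ ^ 2) ^ 2) k‖ = Real.exp S.re ∧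
      ‖D‖ ≤ 0.4133 ∧
      ‖S - ((Real.pi ^ 2 / 12 : ℝ) - D) * (2 * (2 * ((t : ℂ) - φ * Complex.I)))⁻¹‖
        ≤ s * t⁻¹ + L * 8 := by
  have hsq : negNome t φ ^ 2 = Complex.exp (-(2 * ((t : ℂ) - φ * Complex.I))) := by
    rw [negNome_pow]
    simp
  have hx : ‖negNome t φ ^ 2‖ < 1 := norm_pow_succ_lt_one (norm_negNome_lt_one ht φ) 1
  have hw : ‖((negNome t φ ^ 2) ^ 2) ^ k‖ ≤ 0.37 := by
    rw [← pow_mul, ← pow_mul, norm_negNome_pow]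
    refine (Real.exp_le_exp.mpr ?_).trans (Real.exp_neg_one_lt_d9.le.trans (by norm_num))
    push_cast
    linarith
  obtain ⟨S, hS, hsum⟩ := hasSum_log_qPochhammer (x := -negNome t φ ^ 2) (by rwa [norm_neg])
    (norm_pow_succ_lt_one hx 1) k
  obtain ⟨D, hD, hdilog⟩ := exists_hasSum_alternating_dilog hw
  refine ⟨S, D, hS, hD, ?_⟩
  generalize ((negNome t φ ^ 2) ^ 2) ^ k = w at *
  have hcoeff (m : ℕ) : ‖(-1) ^ m / ((m : ℂ) + 1) * (1 - w ^ (m + 1))‖ ≤ 2 / (m + 1) := by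
    have hw1 : ‖1 - w ^ (m + 1)‖ ≤ 2 := by
      refine (norm_sub_le _ _).trans ?_
      rw [norm_one, norm_pow]
      linarith [pow_le_one₀ (n := m + 1) (norm_nonneg w) (by linarith)]
    rw [norm_mul, norm_div, norm_natCast_add_one, norm_pow, norm_neg, norm_one, one_pow,
      one_div_mul_eq_div]
    gcongr
  have hclose := norm_sub_mul_inv_le_of_hasSum (by simpa using ht) hcoeff hL hs
    (hsum.congr_fun fun m => by rw [← neg_logTerm_exp_neg, hsq])
    ((hasSum_alternating_inv_sq_complex.sub hdilog).congr_fun fun m => by ring)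
  refine hclose.trans (le_of_eq ?_)
  rw [show (2 * ((t : ℂ) - φ * Complex.I)).re = 2 * t by simp]
  field_simp
  ring

lemma le_re_sub_mul_inv {τ D : ℂ} (hτ : 0 < τ.re) (hle : ‖τ‖ ≤ 1.81 * τ.re) (hD : ‖D‖ ≤ 0.4133) :
    9 / 2000 * τ.re⁻¹ ≤ (((Real.pi ^ 2 / 12 : ℝ) - D) * (2 * (2 * τ))⁻¹).re := by
  have hpos : 0 < ‖τ‖ := hτ.trans_le (Complex.re_le_norm τ)
  have hpi : (0.82 : ℝ) ≤ Real.pi ^ 2 / 12 := by nlinarith [Real.pi_gt_d2]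
  have hinv : 0.55 * τ.re⁻¹ ≤ ‖τ‖⁻¹ := by
    rw [← div_eq_mul_inv, div_le_iff₀ hτ, inv_mul_eq_div, le_div_iff₀ hpos]
    linarith
  have hratio : 0.55 ≤ τ.re * ‖τ‖⁻¹ := by
    rw [← div_eq_mul_inv, le_div_iff₀ hpos]
    linarith
  have hre : (τ⁻¹).re = τ.re * ‖τ‖⁻¹ * ‖τ‖⁻¹ := by
    rw [Complex.inv_re, Complex.normSq_eq_norm_sq]
    field_simp
  have hDτ : (D * τ⁻¹).re ≤ 0.4133 * ‖τ‖⁻¹ := by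
    refine (Complex.re_le_norm _).trans ?_
    rw [norm_mul, norm_inv]
    gcongr
  have hsplit : (((Real.pi ^ 2 / 12 : ℝ) - D) * (2 * (2 * τ))⁻¹)
      = (1 / 4 : ℝ) * ((Real.pi ^ 2 / 12 : ℝ) * τ⁻¹ - D * τ⁻¹) := by
    push_cast
    ring
  have hmain : 0.55 * 0.82 * ‖τ‖⁻¹ ≤ Real.pi ^ 2 / 12 * (τ.re * ‖τ‖⁻¹ * ‖τ‖⁻¹) := by
    calc _ = 0.82 * (0.55 * ‖τ‖⁻¹) := by ring
      _ ≤ _ := by gcongr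
  rw [hsplit, Complex.re_ofReal_mul, Complex.sub_re, Complex.re_ofReal_mul, hre]
  linarith [inv_pos.mpr hτ]

lemma norm_sub_mul_I_le {t φ : ℝ} (ht : 0 < t) (hφ : |φ| ≤ 3 / 2 * t) :
    ‖(t : ℂ) - φ * Complex.I‖ ≤ 1.81 * t := by
  have hsq : φ ^ 2 ≤ (3 / 2 * t) ^ 2 := sq_le_sq' (neg_le_of_abs_le hφ) (le_of_abs_le hφ)
  rw [← sq_le_sq₀ (norm_nonneg _) (by positivity), ← Complex.normSq_eq_norm_sq,
    Complex.normSq_apply]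
  simp only [Complex.sub_re, Complex.sub_im, Complex.ofReal_re, Complex.ofReal_im,
    Complex.re_ofReal_mul, Complex.im_ofReal_mul, Complex.I_re, Complex.I_im, mul_zero, mul_one,
    sub_zero, zero_sub]
  nlinarith

lemma exp_le_norm_qPochhammer_of_le_mul {L : ℕ} {s t φ : ℝ}
    (hs : HasSum (fun m : ℕ => if L ≤ m then 1 / ((m : ℝ) + 1) ^ 2 else 0) s)
    (hs1 : s ≤ 1 / 2000) (ht : 0 < t) (hL : (L : ℝ) * t ≤ 1 / 20) (hφ : |φ| ≤ 3 / 2 * t) {k : ℕ}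
    (hk : 1 / 4 ≤ (k : ℝ) * t) :
    Real.exp (1 / 250 * t⁻¹ - L * 8)
      ≤ ‖qPochhammer (-negNome t φ ^ 2) ((negNome t φ ^ 2) ^ 2) k‖ := by
  have hτ := norm_sub_mul_I_le ht hφ
  have hLτ : L * ‖2 * ((t : ℂ) - φ * Complex.I)‖ ≤ 1 / 4 := by
    rw [norm_mul, Complex.norm_ofNat]
    calc _ ≤ (L : ℝ) * (2 * (1.81 * t)) := by gcongr
      _ ≤ _ := by linarith
  have hre : ((t : ℂ) - φ * Complex.I).re = t := by simp
  obtain ⟨S, D, hS, hD, hclose⟩ := exists_log_qPochhammer_sub_le hs ht hLτ hk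
  have hmain := le_re_sub_mul_inv (by rwa [hre]) (by rwa [hre]) hD
  have herror := (Complex.re_le_norm _).trans ((norm_sub_rev _ _).trans_le hclose)
  have hst : s * t⁻¹ ≤ 1 / 2000 * t⁻¹ := by gcongr
  rw [hre] at hmain
  rw [Complex.sub_re] at herror
  rw [hS, Real.exp_le_exp]
  linarith

/-! ### The series in a sector at `q = -1` -/

/-- The exponential rate in the sector `|φ| ≤ 3t/2`: up to a power of `t⁻¹` it bounds
`baileyR3 3 (negNome t φ)`. Here `L` counts the terms of a logarithm whose error is `O(1)`. -/
noncomputable def sectorBound (L : ℕ) (t : ℝ) : ℝ :=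
  Real.exp ((Real.pi ^ 2 / 24 - 1 / 20000) * t⁻¹ + L * 12)

section Sector

variable {L k : ℕ} {s t φ : ℝ}

lemma inv_norm_mul_distinctOddProduct_le_of_le_mul
    (hs : HasSum (fun m : ℕ => if L ≤ m then 1 / ((m : ℝ) + 1) ^ 2 else 0) s)
    (hs1 : s ≤ 1 / 20000) (ht : 0 < t) (hL : L * t ≤ 1 / 20) (hφ : |φ| ≤ 3 / 2 * t)
    (hk : 1 / 4 ≤ k * t) :
    ‖(qPochhammer (-negNome t φ ^ 2) ((negNome t φ ^ 2) ^ 2) k)⁻¹‖ *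
      distinctOddProduct (Real.exp (-t)) ≤ sectorBound L t := by
  have hden := exp_le_norm_qPochhammer_of_le_mul hs (by linarith) ht hL hφ hk
  have hst : s * t⁻¹ ≤ 1 / 20000 * t⁻¹ := by gcongr
  rw [norm_inv]
  calc _ ≤ (Real.exp (1 / 250 * t⁻¹ - L * 8))⁻¹ *
        Real.exp ((Real.pi ^ 2 / 24 + s) * t⁻¹ + L * 4) := by
        gcongr
        · exact distinctOddProduct_nonneg _
        · exact distinctOddProduct_exp_neg_le hs ht (by linarith)
    _ ≤ _ := by
        rw [← Real.exp_neg, ← Real.exp_add, sectorBound, Real.exp_le_exp]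
        linarith [inv_pos.mpr ht]

lemma inv_norm_mul_distinctOddProduct_le_of_mul_le
    (hs : HasSum (fun m : ℕ => if L ≤ m then 1 / ((m : ℝ) + 1) ^ 2 else 0) s)
    (hs1 : s ≤ 1 / 20000) (ht : 0 < t) (hL : L * t ≤ 1 / 20) (hφ : |φ| ≤ 3 / 2 * t)
    (hk : 1 / 100 ≤ k * t) (hk' : k * t ≤ 1 / 4) :
    ‖(qPochhammer (-negNome t φ ^ 2) ((negNome t φ ^ 2) ^ 2) k)⁻¹‖ *
      distinctOddProduct (Real.exp (-t)) ≤ sectorBound L t := by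
  have hden := exp_le_norm_qPochhammer_of_mul_le ht hφ hk'
  have hst : s * t⁻¹ ≤ 1 / 20000 * t⁻¹ := by gcongr
  have hkt : 1 / 10000 * t⁻¹ ≤ k / 100 := by
    rw [← div_eq_mul_inv, div_le_iff₀ ht]
    linarith
  rw [norm_inv]
  calc _ ≤ (Real.exp (k / 100))⁻¹ * Real.exp ((Real.pi ^ 2 / 24 + s) * t⁻¹ + L * 4) := by
        gcongr
        · exact distinctOddProduct_nonneg _
        · exact distinctOddProduct_exp_neg_le hs ht (by linarith)
    _ ≤ _ := by
        rw [← Real.exp_neg, ← Real.exp_add, sectorBound, Real.exp_le_exp]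
        linarith [(L.cast_nonneg : (0 : ℝ) ≤ L)]

lemma inv_norm_mul_realFactInv_le (L : ℕ) (ht : 0 < t) (hφ : |φ| ≤ 3 / 2 * t)
    (hk : (k + 1 : ℕ) * t ≤ 1 / 100) :
    ‖(qPochhammer (-negNome t φ ^ 2) ((negNome t φ ^ 2) ^ 2) (k + 1))⁻¹‖ *
      realFactInv (Real.exp (-t) ^ 2) (2 * k + 1) ≤ sectorBound L t := by
  have hden := exp_le_norm_qPochhammer_of_mul_le ht hφ (hk.trans (by norm_num))
  have hinv : ‖(qPochhammer (-negNome t φ ^ 2) ((negNome t φ ^ 2) ^ 2) (k + 1))⁻¹‖ ≤ 1 := by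
    rw [norm_inv]
    exact inv_le_one_of_one_le₀ ((Real.one_le_exp (by positivity)).trans hden)
  have hsq : Real.exp (-t) ^ 2 = Real.exp (-(2 * t)) := by
    rw [← Real.exp_nat_mul]
    push_cast
    ring_nf
  push_cast at hk
  have hfact := realFactInv_le_exp (M := 2 * k + 1) ht (by push_cast; linarith)
  rw [← hsq] at hfact
  have hkt : (k + 1 : ℝ) ≤ 1 / 100 * t⁻¹ := by
    rw [← div_eq_mul_inv, le_div_iff₀ ht]
    linarith
  calc _ ≤ 1 * Real.exp (t⁻¹ / 10 + 3 * (2 * k + 1 : ℕ)) := by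
        gcongr
        exact (realFactInv_pos (by positivity) (by rw [hsq, Real.exp_lt_one_iff]; linarith) _).le
    _ ≤ _ := by
        have hpi : 9 * t⁻¹ ≤ Real.pi ^ 2 * t⁻¹ := by
          gcongr
          nlinarith [Real.pi_gt_three]
        rw [one_mul, sectorBound, Real.exp_le_exp]
        push_cast
        linarith [(L.cast_nonneg : (0 : ℝ) ≤ L)]

/-- For `k` of order at least `1 / t` the denominator gains over the distinct-odd-parts product; for
smaller `k` the finite product `realFactInv` is the better numerator. -/
lemma inv_norm_mul_min_le
    (hs : HasSum (fun m : ℕ => if L ≤ m then 1 / ((m : ℝ) + 1) ^ 2 else 0) s)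
    (hs1 : s ≤ 1 / 20000) (ht : 0 < t) (hL : L * t ≤ 1 / 20) (hφ : |φ| ≤ 3 / 2 * t) (k : ℕ) :
    ‖(qPochhammer (-negNome t φ ^ 2) ((negNome t φ ^ 2) ^ 2) (k + 1))⁻¹‖ *
      min (distinctOddProduct (Real.exp (-t))) (realFactInv (Real.exp (-t) ^ 2) (2 * k + 1))
        ≤ sectorBound L t := by
  rw [mul_min_of_nonneg _ _ (norm_nonneg _)]
  rcases le_total (1 / 4) (((k + 1 : ℕ) : ℝ) * t) with hlarge | hlarge
  · exact min_le_of_left_le (inv_norm_mul_distinctOddProduct_le_of_le_mul hs hs1 ht hL hφ hlarge)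
  rcases le_total (1 / 100) (((k + 1 : ℕ) : ℝ) * t) with hmid | hmid
  · exact min_le_of_left_le
      (inv_norm_mul_distinctOddProduct_le_of_mul_le hs hs1 ht hL hφ hmid hlarge)
  · exact min_le_of_right_le (inv_norm_mul_realFactInv_le L ht hφ hmid)

lemma norm_baileyR3_le_sectorBound
    (hs : HasSum (fun m : ℕ => if L ≤ m then 1 / ((m : ℝ) + 1) ^ 2 else 0) s)
    (hs1 : s ≤ 1 / 20000) (ht : 0 < t) (ht1 : t ≤ 1 / 4) (hL : L * t ≤ 1 / 20)
    (hφ : |φ| ≤ 3 / 2 * t) :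
    ‖baileyR3 3 (negNome t φ)‖
      ≤ Real.exp 10 * sectorBound L t * (3 * (1 - Real.exp (-t))⁻¹ ^ 3) := by
  rw [← norm_negNome t φ]
  refine norm_baileyR3_le_expansion (norm_negNome_lt_one ht φ) (norm_qPochhammer_ratio_le ht ht1 hφ)
    (fun k => ?_) ?_
  · rw [norm_negNome]
    exact inv_norm_mul_min_le hs hs1 ht hL hφ k
  · obtain ⟨K, hK⟩ := exists_nat_ge (1 / 4 / t)
    refine ⟨K, fun k hk => ?_⟩
    rw [norm_negNome]
    exact inv_norm_mul_distinctOddProduct_le_of_le_mul hs hs1 ht hL hφ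
      ((div_le_iff₀ ht).mp (hK.trans (mod_cast hk)))

end Sector

lemma exists_norm_baileyR3_le_near :
    ∃ C t₀ : ℝ, 0 < t₀ ∧ ∀ t φ : ℝ, 0 < t → t ≤ t₀ → |φ| ≤ 3 / 2 * t →
      ‖baileyR3 3 (negNome t φ)‖ ≤
        Real.exp ((Real.pi ^ 2 / 24 - 1 / 20000) * t⁻¹ + C) * (1 - Real.exp (-t))⁻¹ ^ 3 := by
  obtain ⟨L, s, hs, hsum⟩ := exists_inv_sq_tail_le (show (0 : ℝ) < 1 / 20000 by norm_num)
  refine ⟨10 + L * 12 + Real.log 3, 1 / (20 * (L + 1)), by positivity, fun t φ ht ht1 hφ => ?_⟩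
  have hLt : (L + 1) * t ≤ 1 / 20 := by
    rw [le_div_iff₀ (by positivity)] at ht1
    linarith
  refine (norm_baileyR3_le_sectorBound hsum hs ht (by nlinarith [(L.cast_nonneg : (0 : ℝ) ≤ L)])
    (by linarith) hφ).trans (le_of_eq ?_)
  rw [show (Real.pi ^ 2 / 24 - 1 / 20000) * t⁻¹ + (10 + L * 12 + Real.log 3)
    = 10 + ((Real.pi ^ 2 / 24 - 1 / 20000) * t⁻¹ + L * 12) + Real.log 3 by ring, Real.exp_add,
    Real.exp_add, Real.exp_log (by norm_num), sectorBound]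
  ring

lemma exists_norm_baileyR3_le_far :
    ∃ A < Real.pi ^ 2 / 24, ∃ C : ℝ, ∀ t φ : ℝ, 0 < t → |φ| ≤ Real.pi → 3 / 2 * t ≤ |φ| →
      ‖baileyR3 3 (negNome t φ)‖ ≤ Real.exp (A * t⁻¹ + C) * (1 - Real.exp (-t))⁻¹ ^ 3 := by
  obtain ⟨A, hA, C, hquotient⟩ := exists_norm_qPochhammerQuotient_le
  refine ⟨A, hA, C + Real.log 4, fun t φ ht hπ hφ => ?_⟩
  refine (norm_baileyR3_le_product (norm_negNome_lt_one ht φ)).trans ?_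
  have hpos : 0 ≤ (1 - Real.exp (-t))⁻¹ :=
    inv_nonneg.mpr (sub_nonneg.mpr (Real.exp_le_one_iff.mpr (by linarith)))
  rw [norm_negNome, ← add_assoc, Real.exp_add, Real.exp_log (by norm_num), ← mul_assoc]
  gcongr
  exact hquotient t φ ht hπ hφ

lemma inv_one_sub_exp_neg_pow_le {ε t : ℝ} (hε : 0 < ε) (ht : 0 < t) (ht1 : t ≤ 1) :
    (1 - Real.exp (-t))⁻¹ ^ 3 ≤ 48 * ε⁻¹ ^ 3 * Real.exp (ε * t⁻¹) := by
  have hhalf := half_le_one_sub_exp_neg ht.le ht1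
  have hinv : (1 - Real.exp (-t))⁻¹ ≤ (t / 2)⁻¹ := inv_anti₀ (by positivity) hhalf
  have hpos : 0 ≤ (1 - Real.exp (-t))⁻¹ := inv_nonneg.mpr (by linarith)
  calc _ ≤ (t / 2)⁻¹ ^ 3 := by gcongr
    _ = 48 * ε⁻¹ ^ 3 * ((ε * t⁻¹) ^ 3 / (Nat.factorial 3 : ℕ)) := by
        rw [show Nat.factorial 3 = 6 from rfl]
        push_cast
        field_simp
        norm_num
    _ ≤ _ := by
        gcongr
        exact Real.pow_div_factorial_le_exp _ (by positivity) 3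

lemma exp_mul_inv_one_sub_exp_neg_pow_le {A B C t : ℝ} (hAB : A < B) (ht : 0 < t) (ht1 : t ≤ 1) :
    Real.exp (A * t⁻¹ + C) * (1 - Real.exp (-t))⁻¹ ^ 3
      ≤ Real.exp C * (48 * (B - A)⁻¹ ^ 3) * Real.exp (B * t⁻¹) := by
  calc _ ≤ Real.exp (A * t⁻¹ + C) * (48 * (B - A)⁻¹ ^ 3 * Real.exp ((B - A) * t⁻¹)) := by
        gcongr
        exact inv_one_sub_exp_neg_pow_le (sub_pos.mpr hAB) ht ht1
    _ = Real.exp C * (48 * (B - A)⁻¹ ^ 3) * (Real.exp (A * t⁻¹) * Real.exp ((B - A) * t⁻¹)) := by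
        rw [Real.exp_add]
        ring
    _ = _ := by
        rw [← Real.exp_add, ← add_mul, add_sub_cancel]

lemma exists_norm_baileyR3_le :
    ∃ A < Real.pi ^ 2 / 24, ∃ C t₀ : ℝ, 0 < t₀ ∧ ∀ t φ : ℝ, 0 < t → t ≤ t₀ → |φ| ≤ Real.pi →
      ‖baileyR3 3 (negNome t φ)‖ ≤ C * Real.exp (A * t⁻¹) := by
  obtain ⟨A₁, hA₁, C₁, hfar⟩ := exists_norm_baileyR3_le_far
  obtain ⟨C₂, t₀, ht₀, hnear⟩ := exists_norm_baileyR3_le_near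
  obtain ⟨A, hA, hlt⟩ := exists_between
    (max_lt hA₁ (sub_lt_self _ (show (0 : ℝ) < 1 / 20000 by norm_num)))
  obtain ⟨hfarA, hnearA⟩ := max_lt_iff.mp hA
  refine ⟨A, hlt, max (Real.exp C₁ * (48 * (A - A₁)⁻¹ ^ 3))
    (Real.exp C₂ * (48 * (A - (Real.pi ^ 2 / 24 - 1 / 20000))⁻¹ ^ 3)), min t₀ 1,
    lt_min ht₀ one_pos, fun t φ ht htmin hπ => ?_⟩
  obtain ⟨hle, hle1⟩ := le_min_iff.mp htmin
  rw [max_mul_of_nonneg _ _ (Real.exp_pos _).le]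
  rcases le_total (3 / 2 * t) |φ| with hφ | hφ
  · exact le_max_of_le_left ((hfar t φ ht hπ hφ).trans
      (exp_mul_inv_one_sub_exp_neg_pow_le hfarA ht hle1))
  · exact le_max_of_le_right ((hnear t φ ht hle hφ).trans
      (exp_mul_inv_one_sub_exp_neg_pow_le hnearA ht hle1))

lemma exists_nome_eq_negNome (u v : ℝ) :
    ∃ φ, |φ| ≤ Real.pi ∧ nome (u + v * Complex.I) = negNome (2 * Real.pi * v) φ := by
  have hround := abs_sub_round (u - 1 / 2)
  generalize round (u - 1 / 2) = k at hround
  refine ⟨2 * Real.pi * (u - 1 / 2 - k), ?_, ?_⟩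
  · rw [abs_mul, abs_of_pos Real.two_pi_pos]
    nlinarith [Real.pi_pos]
  · have hexponent : 2 * Real.pi * Complex.I * (u + v * Complex.I)
        = (-((2 * Real.pi * v : ℝ) : ℂ) + ((2 * Real.pi * (u - 1 / 2 - k) : ℝ) : ℂ) * Complex.I)
          + Real.pi * Complex.I + k * (2 * Real.pi * Complex.I) := by
      push_cast
      linear_combination (2 * Real.pi * v : ℂ) * Complex.I_sq
    rw [nome, negNome, hexponent, Complex.exp_add, Complex.exp_int_mul_two_pi_mul_I, mul_one,
      Complex.exp_add, Complex.exp_pi_mul_I, mul_neg_one]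

lemma exists_two_pi_div_sqrt_le {t₀ : ℝ} (ht₀ : 0 < t₀) :
    ∃ N : ℕ, ∀ n : ℕ, N ≤ n → 0 < 2 * Real.pi * (1 / Real.sqrt (192 * n)) ∧
      2 * Real.pi * (1 / Real.sqrt (192 * n)) ≤ t₀ := by
  obtain ⟨N, hN⟩ := exists_nat_ge ((2 * Real.pi / t₀) ^ 2)
  refine ⟨N + 1, fun n hn => ?_⟩
  have hNn : (N : ℝ) + 1 ≤ n := mod_cast hn
  have hn0 : (0 : ℝ) < n := by linarith [(N.cast_nonneg : (0 : ℝ) ≤ N)]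
  have hsqrt : 0 < Real.sqrt (192 * n) := Real.sqrt_pos.mpr (by positivity)
  refine ⟨by positivity, ?_⟩
  rw [mul_one_div, div_le_comm₀ hsqrt ht₀]
  exact Real.le_sqrt_of_sq_le (by linarith)

lemma pi_mul_sqrt_div_eq (n : ℝ) :
    Real.pi * Real.sqrt (n / 12)
      = Real.pi ^ 2 / 24 * (2 * Real.pi * (1 / Real.sqrt (192 * n)))⁻¹ := by
  rw [show 192 * n = 48 ^ 2 * (n / 12) by ring, Real.sqrt_mul (by norm_num),
    Real.sqrt_sq (by norm_num), one_div, mul_inv, inv_inv]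
  field_simp
  ring

theorem theorem5p4_general :
    ∃ β : ℝ, 0 < β ∧ ∃ C : ℝ, ∃ N : ℕ, ∀ n : ℕ, N ≤ n → ∀ u v : ℝ,
      v = 1 / Real.sqrt (192 * n) →
        Summable (fun m : {m : Fin 3 → ℕ // Monotone m} =>
          baileyR3Term 3 (nome (u + v * Complex.I)) m.1) ∧
        ‖baileyR3 3 (nome (u + v * Complex.I))‖
          ≤ C * Real.exp (Real.pi * Real.sqrt (n / 12) * (1 - β)) := by
  obtain ⟨A, hA, C, t₀, ht₀, hbound⟩ := exists_norm_baileyR3_le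
  obtain ⟨N, hN⟩ := exists_two_pi_div_sqrt_le ht₀
  refine ⟨1 - A / (Real.pi ^ 2 / 24), sub_pos.mpr ((div_lt_one (by positivity)).mpr hA), C, N,
    fun n hn u v hv => ?_⟩
  subst hv
  obtain ⟨ht, hle⟩ := hN n hn
  obtain ⟨φ, hφ, hq⟩ := exists_nome_eq_negNome u (1 / Real.sqrt (192 * n))
  rw [hq]
  refine ⟨summable_baileyR3Term (norm_negNome_lt_one ht φ),
    (hbound _ φ ht hle hφ).trans (le_of_eq ?_)⟩
  rw [sub_sub_cancel, pi_mul_sqrt_div_eq]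
  congr 2
  field_simp

theorem theorem5p4 (M : ℝ) (hM : 0 < M) :
    ∃ β : ℝ, 0 < β ∧ ∃ C : ℝ, ∃ N : ℕ, ∀ n : ℕ, N ≤ n → ∀ u v : ℝ,
      v = 1 / Real.sqrt (192 * n) → M * v < |u - 1 / 2| →
        Summable (fun m : {m : Fin 3 → ℕ // Monotone m} =>
          baileyR3Term 3 (nome (u + v * Complex.I)) m.1) ∧
        ‖baileyR3 3 (nome (u + v * Complex.I))‖
          ≤ C * Real.exp (Real.pi * Real.sqrt (n / 12) * (1 - β)) := by
  obtain ⟨β, hβ, C, N, h⟩ := theorem5p4_general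
  exact ⟨β, hβ, C, N, fun n hn u v hv _ => h n hn u v hv⟩
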